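/- Let $\mathbb{T}=\mathbb{R}/\mathbb{Z}$ with normalised Haar measure, $\widehat f(n)=\int_{\mathbb{T}} f(x)e^{-2\pi i n x}\,dx$, and let $L\log^{1/2}L(\mathbb{T})$ be the class of measurable $f:\mathbb{T}\to\mathbb{C}$ with $\int_{\mathbb{T}}|f|\log^{1/2}(1+|f|)<\infty$. A bounded $m:\mathbb{Z}\to\mathbb{C}$ is a multiplier from $L\log^{1/2}L(\mathbb{T})$ to $L^2(\mathbb{T})$ if $\sum_{n\in\mathbb{Z}}|m(n)\widehat f(n)|^2<\infty$ for every $f\in L\log^{1/2}L(\mathbb{T})$. A function $m:\mathbb{Z}\to\mathbb{C}$ is a Sidon weight if there is $S>0$ such that $\sum_{n}|m(n)\widehat f(n)|\le S\|f\|_{L^\infty(\mathbb{T})}$ for every trigonometric polynomial $f$ with $\operatorname{supp}\widehat f\subseteq\operatorname{supp} m$. For a trigonometric polynomial $f$ put $[|f|]=\mathbb{E}\big\|\sum_n r_n\widehat f(n)e^{2\pi i n x}\big\|_{L^\infty(\mathbb{T})}$, where the $r_n$ are independent uniform random signs (Rademacher functions), and say that $m$ satisfies the weighted Rider condition if there is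 $R>0$ such that $\sum_n|m(n)\widehat f(n)|\le R\,[|f|]$ for every trigonometric polynomial $f$ with $\operatorname{supp}\widehat f\subseteq\operatorname{supp} m$. Let $m(n)=|n|^{-1/2}$ for $n\ne0$ and $m(0)=0$. Then $m$ is a multiplier from $L\log^{1/2}L(\mathbb{T})$ to $L^2(\mathbb{T})$ and satisfies the weighted Rider condition, but $m$ is not a Sidon weight. Consequently the weighted analogue of Rider's theorem fails: neither does every multiplier from $L\log^{1/2}L(\mathbb{T})$ to $L^2(\mathbb{T})$ have to be a Sidon weight, nor does every $m:\mathbb{Z}\to\mathbb{C}$ satisfying the weighted Rider condition. -/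

import Mathlib

open MeasureTheory AddCircle
open scoped BigOperators

noncomputable section

/-- The class `L log^r L(𝕋)`, `𝕋 = ℝ/ℤ`: measurable `f` with `∫ |f| log^r (1 + |f|) < ∞`. -/
def LLog (r : ℝ) : Set (UnitAddCircle → ℂ) :=
  {f | AEStronglyMeasurable f haarAddCircle ∧
    Integrable (fun x => ‖f x‖ * Real.log (1 + ‖f x‖) ^ r) haarAddCircle}

/-- `m ∈ ℓ^∞(ℤ)` is a multiplier from `X` (a space of integrable functions on `𝕋`) to `L²(𝕋)`. -/
def IsMultiplierToL2 (X : Set (UnitAddCircle → ℂ)) (m : ℤ → ℂ) : Prop :=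
  (∃ C : ℝ, ∀ n, ‖m n‖ ≤ C) ∧ ∀ f ∈ X, Summable fun n : ℤ => ‖m n * fourierCoeff f n‖ ^ 2

/-- The trigonometric polynomial `∑ a(n) e^{2πinx}` with coefficients `a`. -/
def trigPoly (a : ℤ →₀ ℂ) : C(UnitAddCircle, ℂ) := ∑ n ∈ a.support, a n • fourier n

theorem fourierCoeff_trigPoly (a : ℤ →₀ ℂ) (k : ℤ) : fourierCoeff (trigPoly a) k = a k := by
  have h1 : ∀ n : ℤ, ∫ t : UnitAddCircle, fourier (-k) t • (a n • fourier n t) ∂haarAddCircle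
      = if n = k then a n else 0 := by
    intro n
    have h2 := fourierCoeff_fourier (T := (1 : ℝ)) n
    have h3 := congrFun h2 k
    rw [fourierCoeff] at h3
    simp_rw [smul_comm _ (a n)]
    rw [integral_smul, h3, Pi.single_apply]
    by_cases h : n = k
    · simp [h]
    · simp [h, Ne.symm h]
  rw [fourierCoeff]
  have h4 : ∀ t : UnitAddCircle, fourier (-k) t • trigPoly a t
      = ∑ n ∈ a.support, fourier (-k) t • (a n • fourier n t) := by
    intro t
    simp [trigPoly, ContinuousMap.sum_apply, Finset.mul_sum]
  simp_rw [h4]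
  rw [integral_finsetSum]
  · simp_rw [h1]
    simp [eq_comm]
  · intro n _
    refine Continuous.integrable_of_hasCompactSupport (by fun_prop) ?_
    exact HasCompactSupport.of_compactSpace _

/-- `m` is a Sidon weight on `𝕋`: `∑ |m(n) f̂(n)| ≤ S ‖f‖_∞` for every trigonometric polynomial `f`
whose Fourier transform is supported in `supp m`. -/
def IsSidonWeight (m : ℤ → ℂ) : Prop :=
  ∃ S : ℝ, 0 < S ∧ ∀ a : ℤ →₀ ℂ, (a.support : Set ℤ) ⊆ Function.support m →
    ∑ n ∈ a.support, ‖m n * a n‖ ≤ S * ‖trigPoly a‖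

/-- `[|f|] = 𝔼 ‖∑ r_n f̂(n) e^{2πinx}‖_∞` for the trigonometric polynomial `f` with coefficients `a`:
independent uniform signs `r_n`, so the expectation is the average over all choices of signs
on the spectrum of `f`. -/
def rademacherNorm (a : ℤ →₀ ℂ) : ℝ :=
  (∑ ε : a.support → ℤˣ,
    ‖∑ n : a.support, (((ε n : ℤ) : ℂ) * a n) • (fourier (n : ℤ) : C(UnitAddCircle, ℂ))‖) /
      2 ^ a.support.card

/-- The weighted form of the hypothesis of Rider's theorem: `∑ |m(n) f̂(n)| ≤ R [|f|]` for every
trigonometric polynomial `f` whose Fourier transform is supported in `supp m`. -/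
def SatisfiesRider (m : ℤ → ℂ) : Prop :=
  ∃ R : ℝ, 0 < R ∧ ∀ a : ℤ →₀ ℂ, (a.support : Set ℤ) ⊆ Function.support m →
    ∑ n ∈ a.support, ‖m n * a n‖ ≤ R * rademacherNorm a

/-- The sequence `m(n) = |n|^{-1/2}` for `n ≠ 0`, `m(0) = 0`. -/
def invSqrtWeight (n : ℤ) : ℂ :=
  if n = 0 then 0 else ((1 / Real.sqrt |(n : ℝ)| : ℝ) : ℂ)

end

/-! The three assertions about `m(n) = |n|^{-1/2}` have independent proofs, and the two failures of
Rider's theorem follow from them at once.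

Not Sidon: by duality, a Sidon weight bounds the `L¹` norms of all sums `∑ ± m(n) e^{-2πinx}`
uniformly. Averaging over the signs and applying Khinchine's inequality pointwise in `x` forces `∑
|m(n)|² < ∞` (`sum_sq_le_of_sidon`), whereas here that sum is harmonic.

Rider: let `σ_q` be the `ℓ²` norm of the coefficients with `2^q ≤ |n| < 2^{q+1}`. Since `∑ |m(n)|²`
over a dyadic block is bounded, Cauchy–Schwarz reduces the claim to `∑ σ_q ≤ C [|f|]`. Block `q`
varies by about `σ_q` over distances `2^{-q}` and is nearly constant at much finer scales. So a
point where the random sum is large can be found greedily: each block chooses between two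
subintervals, gains a multiple of `σ_q` on average, and leaves the finer blocks free
(`sum_le_expect_of_separated_blocks`). Separation of scales is obtained by treating the residue
classes of `q` mod 7 one at a time.

Multiplier: `∑_{n≥1} |f̂(n)|²/n` is the limit as `r → 1` of the energy of `f` for the kernel `-log(1
- r e^{2πi(x-y)})`. An elementary inequality of Young type (`mul_mul_le_of_sqrt_log`) dominates the
integrand, uniformly in `r`, by a product of two `L log^{1/2} L` densities plus `|f|` against an
integrable square-root singularity. -/

theorem sum_signs_mul_mulSingle {ι : Type*} [DecidableEq ι] {s : Finset ι} {i : ι} (hi : i ∉ s)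
    (b : ι → ℝ) (ε : ι → ℤˣ) :
    ∑ j ∈ s, (((ε * (Pi.mulSingle i (-1) : ι → ℤˣ)) j : ℤ) : ℝ) * b j =
      ∑ j ∈ s, ((ε j : ℤ) : ℝ) * b j := by
  refine Finset.sum_congr rfl fun j hj => ?_
  have : j ≠ i := fun h => hi (h ▸ hj)
  simp [Pi.mulSingle_eq_of_ne this]

/-! ### Averages over random signs and Khinchine's inequality -/

section Signs

variable {ι : Type*} [Fintype ι] [DecidableEq ι]

theorem expect_signs_mul_right (δ : ι → ℤˣ) (F : (ι → ℤˣ) → ℝ) :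
    𝔼 ε, F (ε * δ) = 𝔼 ε, F ε :=
  Fintype.expect_equiv (Equiv.mulRight δ) _ _ fun _ => rfl

/-- Resampling the signs outside `B` does not change the average. -/
theorem expect_signs_piecewise (B : Finset ι) (F : (ι → ℤˣ) → ℝ) :
    𝔼 ε : ι → ℤˣ, 𝔼 ε' : ι → ℤˣ, F (B.piecewise ε ε') = 𝔼 ε, F ε := by
  -- `e` exchanges the coordinates outside `B` between the two sign patterns, so it permutes the
  -- product space.
  let e : (ι → ℤˣ) × (ι → ℤˣ) → (ι → ℤˣ) × (ι → ℤˣ) :=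
    fun p => (B.piecewise p.1 p.2, B.piecewise p.2 p.1)
  have he : Function.Involutive e := by
    rintro ⟨p, q⟩
    ext i <;> by_cases h : i ∈ B <;> simp [e, h]
  have h1 : 𝔼 p : (ι → ℤˣ) × (ι → ℤˣ), F (B.piecewise p.1 p.2) =
      𝔼 p : (ι → ℤˣ) × (ι → ℤˣ), F p.1 :=
    Fintype.expect_equiv he.toPerm _ _ fun _ => rfl
  rw [← Finset.univ_product_univ, Finset.expect_product, Finset.expect_product] at h1
  simpa using h1

theorem units_sq_cast (u : ℤˣ) : ((u : ℤ) : ℝ) ^ 2 = 1 := by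
  rcases Int.units_eq_one_or u with rfl | rfl <;> simp

/-- Averaging first over the sign with index `i`. -/
theorem expect_signs_split (i : ι) (F : (ι → ℤˣ) → ℝ) :
    𝔼 ε, F ε = 𝔼 ε : ι → ℤˣ, (F ε + F (ε * Pi.mulSingle i (-1))) / 2 := by
  rw [← Finset.expect_div, Finset.expect_add_distrib, expect_signs_mul_right]
  ring

theorem expect_signs_sum (s : Finset ι) (b : ι → ℝ) :
    𝔼 ε : ι → ℤˣ, ∑ i ∈ s, ((ε i : ℤ) : ℝ) * b i = 0 := by
  induction s using Finset.induction_on with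
  | empty => simp
  | insert i s hi ih =>
    rw [expect_signs_split i, ← ih]
    refine Finset.expect_congr rfl fun ε _ => ?_
    simp only [Finset.sum_insert hi, sum_signs_mul_mulSingle hi]
    simp only [Pi.mul_apply, Pi.mulSingle_eq_same, mul_neg, mul_one, Units.val_neg, Int.cast_neg]
    ring

theorem expect_signs_sum_sq (s : Finset ι) (b : ι → ℝ) :
    𝔼 ε : ι → ℤˣ, (∑ i ∈ s, ((ε i : ℤ) : ℝ) * b i) ^ 2 = ∑ i ∈ s, b i ^ 2 := by
  induction s using Finset.induction_on with
  | empty => simp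
  | insert i s hi ih =>
    rw [expect_signs_split i, Finset.sum_insert hi, ← ih,
      ← Fintype.expect_const (ι := ι → ℤˣ) (b i ^ 2), ← Finset.expect_add_distrib]
    refine Finset.expect_congr rfl fun ε _ => ?_
    simp only [Finset.sum_insert hi, sum_signs_mul_mulSingle hi]
    simp only [Pi.mul_apply, Pi.mulSingle_eq_same, mul_neg, mul_one, Units.val_neg, Int.cast_neg]
    linear_combination (b i ^ 2) * units_sq_cast (ε i)

/-- Averaging over one new sign kills the odd powers, so the fourth moment grows by `b⁴ + 6b²V`,
where `V` is the old variance. This is at most `3(b² + V)² - 3V²`. -/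
theorem expect_signs_sum_pow_four_le (s : Finset ι) (b : ι → ℝ) :
    𝔼 ε : ι → ℤˣ, (∑ i ∈ s, ((ε i : ℤ) : ℝ) * b i) ^ 4 ≤ 3 * (∑ i ∈ s, b i ^ 2) ^ 2 := by
  induction s using Finset.induction_on with
  | empty => simp
  | insert i s hi ih =>
    have h : 𝔼 ε : ι → ℤˣ, (∑ i ∈ insert i s, ((ε i : ℤ) : ℝ) * b i) ^ 4 =
        b i ^ 4 + 6 * b i ^ 2 * ∑ i ∈ s, b i ^ 2 +
          𝔼 ε : ι → ℤˣ, (∑ i ∈ s, ((ε i : ℤ) : ℝ) * b i) ^ 4 := by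
      rw [expect_signs_split i, ← expect_signs_sum_sq s, Finset.mul_expect,
        ← Fintype.expect_const (ι := ι → ℤˣ) (b i ^ 4), ← Finset.expect_add_distrib,
        ← Finset.expect_add_distrib]
      refine Finset.expect_congr rfl fun ε _ => ?_
      simp only [Finset.sum_insert hi, sum_signs_mul_mulSingle hi]
      simp only [Pi.mul_apply, Pi.mulSingle_eq_same, mul_neg, mul_one, Units.val_neg, Int.cast_neg]
      linear_combination (b i ^ 4 * (((ε i : ℤ) : ℝ) ^ 2 + 1) +
        6 * b i ^ 2 * (∑ j ∈ s, ((ε j : ℤ) : ℝ) * b j) ^ 2) * units_sq_cast (ε i)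
    rw [h, Finset.sum_insert hi]
    nlinarith [sq_nonneg (b i ^ 2)]

/-- The lower `L¹` Khinchine inequality. -/
theorem half_sqrt_le_expect_signs_abs (s : Finset ι) (b : ι → ℝ) :
    √(∑ i ∈ s, b i ^ 2) / 2 ≤ 𝔼 ε : ι → ℤˣ, |∑ i ∈ s, ((ε i : ℤ) : ℝ) * b i| := by
  set V := ∑ i ∈ s, b i ^ 2 with hV
  have hV0 : 0 ≤ V := Finset.sum_nonneg fun i _ => sq_nonneg _
  rcases hV0.eq_or_lt with h0 | hpos
  · rw [← h0]
    simpa using Finset.expect_nonneg fun _ _ => abs_nonneg _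
  set σ := √V
  have hσ : 0 < σ := Real.sqrt_pos.2 hpos
  have hσ2 : σ ^ 2 = V := Real.sq_sqrt hV0
  -- Minorise `|t|` by a combination of `t²` and `t⁴`, whose moments are controlled. After scaling
  -- by `σ`, `1 - u + 4u³/27 = (4/27)(u - 3/2)²(u + 3) ≥ 0`. Taking averages gives `σ(1 - 3·4/27) =
  -- 5σ/9 ≥ σ/2`.
  have key : ∀ t : ℝ, t ^ 2 * σ⁻¹ - 4 / 27 * (t ^ 4 * (σ⁻¹) ^ 3) ≤ |t| := by
    intro t
    have h1 : ∀ u : ℝ, 0 ≤ u → u ^ 2 - 4 / 27 * u ^ 4 ≤ u := by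
      intro u hu
      nlinarith [mul_nonneg hu (mul_nonneg (sq_nonneg (u - 3 / 2)) (by linarith : 0 ≤ u + 3))]
    have h2 := mul_le_mul_of_nonneg_left (h1 (|t| * σ⁻¹) (by positivity)) hσ.le
    have h3 : σ * (|t| * σ⁻¹) = |t| := by field_simp
    rw [h3, mul_pow, mul_pow, sq_abs, show |t| ^ 4 = t ^ 4 by
      rw [show (4 : ℕ) = 2 * 2 by rfl, pow_mul, pow_mul, sq_abs]] at h2
    refine le_trans (le_of_eq ?_) h2
    field_simp
  have h4 := Finset.expect_le_expect (s := (Finset.univ : Finset (ι → ℤˣ)))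
    fun ε _ => key (∑ i ∈ s, ((ε i : ℤ) : ℝ) * b i)
  rw [Finset.expect_sub_distrib, ← Finset.expect_mul, ← Finset.mul_expect, ← Finset.expect_mul,
    expect_signs_sum_sq] at h4
  refine le_trans ?_ h4
  have h5 := mul_le_mul_of_nonneg_right (expect_signs_sum_pow_four_le s b)
    (by positivity : 0 ≤ (σ⁻¹) ^ 3)
  rw [← hV, ← hσ2] at h5 ⊢
  have h6 : 3 * (σ ^ 2) ^ 2 * σ⁻¹ ^ 3 = 3 * σ := by field_simp
  have h7 : σ ^ 2 * σ⁻¹ = σ := by field_simp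
  rw [h6] at h5
  rw [h7]
  linarith

theorem quarter_sqrt_le_expect_signs_norm (s : Finset ι) (z : ι → ℂ) :
    √(∑ i ∈ s, ‖z i‖ ^ 2) / 4 ≤ 𝔼 ε : ι → ℤˣ, ‖∑ i ∈ s, ((ε i : ℤ) : ℂ) * z i‖ := by
  have h1 := half_sqrt_le_expect_signs_abs s fun i => (z i).re
  have h2 := half_sqrt_le_expect_signs_abs s fun i => (z i).im
  have h3 : √(∑ i ∈ s, ‖z i‖ ^ 2) ≤ √(∑ i ∈ s, (z i).re ^ 2) + √(∑ i ∈ s, (z i).im ^ 2) := by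
    have h4 : ∑ i ∈ s, ‖z i‖ ^ 2 = ∑ i ∈ s, (z i).re ^ 2 + ∑ i ∈ s, (z i).im ^ 2 := by
      rw [← Finset.sum_add_distrib]
      refine Finset.sum_congr rfl fun i _ => ?_
      rw [Complex.sq_norm, Complex.normSq_apply]; ring
    rw [h4]
    have hr : 0 ≤ ∑ i ∈ s, (z i).re ^ 2 := Finset.sum_nonneg fun i _ => sq_nonneg _
    have hi : 0 ≤ ∑ i ∈ s, (z i).im ^ 2 := Finset.sum_nonneg fun i _ => sq_nonneg _
    refine Real.sqrt_le_iff.2 ⟨by positivity, ?_⟩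
    nlinarith [Real.sq_sqrt hr, Real.sq_sqrt hi, Real.sqrt_nonneg (∑ i ∈ s, (z i).re ^ 2),
      Real.sqrt_nonneg (∑ i ∈ s, (z i).im ^ 2)]
  have h5 : (𝔼 ε : ι → ℤˣ, |∑ i ∈ s, ((ε i : ℤ) : ℝ) * (z i).re|) +
      (𝔼 ε : ι → ℤˣ, |∑ i ∈ s, ((ε i : ℤ) : ℝ) * (z i).im|) ≤
      2 * 𝔼 ε : ι → ℤˣ, ‖∑ i ∈ s, ((ε i : ℤ) : ℂ) * z i‖ := by
    rw [← Finset.expect_add_distrib, Finset.mul_expect]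
    refine Finset.expect_le_expect fun ε _ => ?_
    have hr := Complex.abs_re_le_norm (∑ i ∈ s, ((ε i : ℤ) : ℂ) * z i)
    have hi := Complex.abs_im_le_norm (∑ i ∈ s, ((ε i : ℤ) : ℂ) * z i)
    simp only [Complex.re_sum, Complex.im_sum, Complex.mul_re, Complex.mul_im, Complex.intCast_re,
      Complex.intCast_im, zero_mul, sub_zero, add_zero] at hr hi
    linarith
  linarith

end Signs

/-! ### Sidon weights are square summable, and `|n|^{-1/2}` is not -/

theorem continuous_integrable_haar (f : C(UnitAddCircle, ℂ)) :
    Integrable f (haarAddCircle : Measure UnitAddCircle) :=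
  f.continuous.integrable_of_hasCompactSupport (HasCompactSupport.of_compactSpace _)

theorem exists_trigPoly_norm_sub_lt (h : C(UnitAddCircle, ℂ)) {δ : ℝ} (hδ : 0 < δ) :
    ∃ a : ℤ →₀ ℂ, ‖h - trigPoly a‖ < δ := by
  have h1 : h ∈ closure ((Submodule.span ℂ (Set.range (@fourier (1 : ℝ)))) :
      Set C(UnitAddCircle, ℂ)) := by
    rw [← Submodule.topologicalClosure_coe, span_fourier_closure_eq_top]
    trivial
  obtain ⟨p, hp, hd⟩ := Metric.mem_closure_iff.1 h1 δ hδ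
  obtain ⟨a, rfl⟩ := (Finsupp.mem_span_range_iff_exists_finsupp).1 hp
  exact ⟨a, by rwa [dist_eq_norm] at hd⟩

theorem trigPoly_erase_zero (a : ℤ →₀ ℂ) :
    trigPoly (a.erase 0) = trigPoly a - a 0 • (fourier 0 : C(UnitAddCircle, ℂ)) := by
  unfold trigPoly
  rw [Finsupp.support_erase]
  by_cases h : (0 : ℤ) ∈ a.support
  · rw [eq_sub_iff_add_eq, ← Finset.sum_erase_add _ _ h]
    congr 1
    refine Finset.sum_congr rfl fun n hn => ?_
    rw [Finsupp.erase_ne (Finset.ne_of_mem_erase hn)]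
  · have hz : (0 : ℂ) • (fourier 0 : C(UnitAddCircle, ℂ)) = 0 := by ext; simp
    rw [Finset.erase_eq_of_notMem h, Finsupp.notMem_support_iff.1 h, hz, sub_zero]
    refine Finset.sum_congr rfl fun n hn => ?_
    have hn0 : n ≠ 0 := fun h0 => h (h0 ▸ hn)
    rw [Finsupp.erase_ne hn0]

theorem norm_fourierCoeff_le_norm (p : C(UnitAddCircle, ℂ)) (n : ℤ) :
    ‖fourierCoeff p n‖ ≤ ‖p‖ := by
  have h1 : ‖∫ t : UnitAddCircle, fourier (-n) t • p t ∂haarAddCircle‖ ≤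
      ‖p‖ * (haarAddCircle : Measure UnitAddCircle).real Set.univ :=
    norm_integral_le_of_norm_le_const (Filter.Eventually.of_forall fun t => by
      rw [norm_smul]
      have h2 : ‖fourier (-n) t‖ ≤ 1 := by
        simpa [fourier_norm] using (fourier (-n) : C(UnitAddCircle, ℂ)).norm_coe_le_norm t
      calc _ ≤ 1 * ‖p‖ := mul_le_mul h2 (p.norm_coe_le_norm t) (norm_nonneg _) zero_le_one
        _ = ‖p‖ := one_mul _)
  simpa [fourierCoeff] using h1

/-- If `m` is a Sidon weight, the sums `∑ w(n) m(n) e^{-2πinx}` with `|w| ≤ 1` are bounded in `L¹`. -/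
theorem integral_norm_le_of_sidon {m : ℤ → ℂ} {S : ℝ} (hm : ∀ n, n ≠ 0 → m n ≠ 0) (hS0 : 0 ≤ S)
    (hS : ∀ a : ℤ →₀ ℂ, (a.support : Set ℤ) ⊆ Function.support m →
      ∑ n ∈ a.support, ‖m n * a n‖ ≤ S * ‖trigPoly a‖)
    (s : Finset ℤ) (hs : (0 : ℤ) ∉ s) (w : ℤ → ℂ) (hw : ∀ n, ‖w n‖ ≤ 1) :
    ∫ x : UnitAddCircle, ‖∑ n ∈ s, w n * m n * fourier (-n) x‖ ∂haarAddCircle ≤ 6 * S + 1 := by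
  set g : C(UnitAddCircle, ℂ) := ∑ n ∈ s, (w n * m n) • fourier (-n) with hg
  have hgx : ∀ x, g x = ∑ n ∈ s, w n * m n * fourier (-n) x := by
    intro x; simp [hg, ContinuousMap.sum_apply]
  simp_rw [← hgx]
  have hpos : ∀ x, (0 : ℝ) < ‖g x‖ + 1 / 2 := fun x => by positivity
  -- A continuous substitute for the conjugate phase of `g`: the `1/2` in the denominator avoids
  -- division by zero and costs at most `1/2` in `∫ h g` compared with `∫ |g|`.
  set h : C(UnitAddCircle, ℂ) :=
    ⟨fun x => (starRingEnd ℂ) (g x) * (((‖g x‖ + 1 / 2)⁻¹ : ℝ) : ℂ), by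
      refine (Complex.continuous_conj.comp g.continuous).mul (Complex.continuous_ofReal.comp ?_)
      exact (g.continuous.norm.add continuous_const).inv₀ fun x => (hpos x).ne'⟩ with hh
  have hh1 : ‖h‖ ≤ 1 := by
    refine (ContinuousMap.norm_le _ zero_le_one).2 fun x => ?_
    have : ‖h x‖ = ‖g x‖ * (‖g x‖ + 1 / 2)⁻¹ := by
      simp only [hh, ContinuousMap.coe_mk, norm_mul, RCLike.norm_conj, Complex.norm_real,
        Real.norm_of_nonneg (inv_nonneg.2 (hpos x).le)]
    rw [this, ← div_eq_mul_inv, div_le_one (hpos x)]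
    linarith
  -- An error of `1/2` suffices, since it contributes `½ ∫ |g|`, which is absorbed on the left: `∫
  -- |g| - 1/2 ≤ 3S + ½ ∫ |g|`.
  obtain ⟨a, ha⟩ := exists_trigPoly_norm_sub_lt h (by norm_num : (0 : ℝ) < 1 / 2)
  have hp : ‖trigPoly a‖ ≤ 3 / 2 := by
    have := norm_sub_norm_le (trigPoly a) h
    rw [norm_sub_rev] at this
    linarith
  have hint : ∀ p : C(UnitAddCircle, ℂ),
      ∫ x : UnitAddCircle, p x * g x ∂haarAddCircle = ∑ n ∈ s, w n * m n * fourierCoeff p n := by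
    intro p
    simp_rw [hgx, Finset.mul_sum, fourierCoeff]
    rw [integral_finsetSum]
    · refine Finset.sum_congr rfl fun n _ => ?_
      rw [← integral_const_mul]
      congr 1; ext x; simp only [smul_eq_mul]; ring
    · intro n _
      exact (continuous_integrable_haar (p * ((w n * m n) • fourier (-n)))).congr
        (Filter.Eventually.of_forall fun x => by simp)
  have hup : ‖∫ x : UnitAddCircle, trigPoly a x * g x ∂haarAddCircle‖ ≤ 3 * S := by
    rw [hint]
    -- The frequency `0` may lie outside the support of `m`, so it is removed; as `0 ∉ s`, the
    -- pairing with `g` does not see it, and the sup norm at most doubles.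
    have h1 := hS (a.erase 0) (by
      intro n hn
      refine hm n ?_
      rintro rfl
      simp at hn)
    have h2 : ‖trigPoly (a.erase 0)‖ ≤ 3 := by
      rw [trigPoly_erase_zero]
      have h3 := norm_fourierCoeff_le_norm (trigPoly a) 0
      rw [fourierCoeff_trigPoly] at h3
      calc _ ≤ ‖trigPoly a‖ + ‖a 0 • (fourier 0 : C(UnitAddCircle, ℂ))‖ := norm_sub_le _ _
        _ ≤ 3 / 2 + 3 / 2 := by
          refine add_le_add hp ?_
          rw [norm_smul, fourier_norm, mul_one]
          linarith
        _ = 3 := by norm_num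
    calc _ ≤ ∑ n ∈ s, ‖w n * m n * fourierCoeff (trigPoly a) n‖ := norm_sum_le _ _
      _ ≤ ∑ n ∈ s, ‖m n * a.erase 0 n‖ := by
        refine Finset.sum_le_sum fun n hn => ?_
        have hn0 : n ≠ 0 := fun h0 => hs (h0 ▸ hn)
        rw [fourierCoeff_trigPoly, Finsupp.erase_ne hn0, mul_assoc, norm_mul]
        exact mul_le_of_le_one_left (norm_nonneg _) (hw n)
      _ ≤ ∑ n ∈ (a.erase 0).support ∪ s, ‖m n * a.erase 0 n‖ :=
        Finset.sum_le_sum_of_subset_of_nonneg Finset.subset_union_right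
          fun _ _ _ => norm_nonneg _
      _ = ∑ n ∈ (a.erase 0).support, ‖m n * a.erase 0 n‖ := by
        refine (Finset.sum_subset Finset.subset_union_left fun n _ hn => ?_).symm
        rw [Finsupp.notMem_support_iff.1 hn, mul_zero, norm_zero]
      _ ≤ S * ‖trigPoly (a.erase 0)‖ := h1
      _ ≤ 3 * S := by nlinarith
  have hgi : Integrable (fun x => ‖g x‖) (haarAddCircle : Measure UnitAddCircle) :=
    (continuous_integrable_haar g).norm
  have hlow : (∫ x, ‖g x‖ ∂(haarAddCircle : Measure UnitAddCircle)) - 1 / 2 ≤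
      ‖∫ x : UnitAddCircle, h x * g x ∂haarAddCircle‖ := by
    have h1 : ∀ x, h x * g x = ((‖g x‖ ^ 2 * (‖g x‖ + 1 / 2)⁻¹ : ℝ) : ℂ) := by
      intro x
      simp only [hh, ContinuousMap.coe_mk]
      rw [mul_right_comm, Complex.conj_mul']
      push_cast; ring
    simp_rw [h1]
    rw [integral_complex_ofReal, Complex.norm_real]
    refine le_trans ?_ (le_abs_self _)
    have h2 : ∫ x, (‖g x‖ - 1 / 2) ∂(haarAddCircle : Measure UnitAddCircle) =
        (∫ x, ‖g x‖ ∂(haarAddCircle : Measure UnitAddCircle)) - 1 / 2 := by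
      rw [integral_sub hgi (integrable_const _)]
      simp
    rw [← h2]
    refine integral_mono (hgi.sub (integrable_const _)) ?_ fun x => ?_
    · refine Continuous.integrable_of_hasCompactSupport ?_ (HasCompactSupport.of_compactSpace _)
      exact (g.continuous.norm.pow 2).mul
        ((g.continuous.norm.add continuous_const).inv₀ fun x => (hpos x).ne')
    · have := hpos x
      simp only
      rw [← div_eq_mul_inv, le_div_iff₀ this]
      nlinarith
  have hdiff : ‖(∫ x : UnitAddCircle, h x * g x ∂haarAddCircle) -
      ∫ x : UnitAddCircle, trigPoly a x * g x ∂haarAddCircle‖ ≤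
      1 / 2 * ∫ x, ‖g x‖ ∂(haarAddCircle : Measure UnitAddCircle) := by
    have e1 : Integrable (fun x => h x * g x) (haarAddCircle : Measure UnitAddCircle) :=
      continuous_integrable_haar (h * g)
    have e2 : Integrable (fun x => trigPoly a x * g x) (haarAddCircle : Measure UnitAddCircle) :=
      continuous_integrable_haar (trigPoly a * g)
    rw [← integral_sub e1 e2, ← integral_const_mul]
    refine norm_integral_le_of_norm_le (hgi.const_mul _) (Filter.Eventually.of_forall fun x => ?_)
    rw [← sub_mul, norm_mul]
    exact mul_le_mul_of_nonneg_right
      (((h - trigPoly a).norm_coe_le_norm x).trans ha.le) (norm_nonneg _)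
  have := norm_sub_norm_le (∫ x : UnitAddCircle, h x * g x ∂haarAddCircle)
    (∫ x : UnitAddCircle, trigPoly a x * g x ∂haarAddCircle)
  linarith

theorem norm_fourier_apply (n : ℤ) (x : UnitAddCircle) : ‖fourier n x‖ = 1 := Circle.norm_coe _

/-- A nonvanishing (off `0`) Sidon weight is square summable. -/
theorem sum_sq_le_of_sidon {m : ℤ → ℂ} {S : ℝ} (hm : ∀ n, n ≠ 0 → m n ≠ 0) (hS0 : 0 ≤ S)
    (hS : ∀ a : ℤ →₀ ℂ, (a.support : Set ℤ) ⊆ Function.support m →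
      ∑ n ∈ a.support, ‖m n * a n‖ ≤ S * ‖trigPoly a‖)
    (s : Finset ℤ) (hs : (0 : ℤ) ∉ s) :
    √(∑ n ∈ s, ‖m n‖ ^ 2) ≤ 4 * (6 * S + 1) := by
  have h1 : ∀ ε : s → ℤˣ, ∫ x : UnitAddCircle,
      ‖∑ n : s, ((ε n : ℤ) : ℂ) * (m n * fourier (-(n : ℤ)) x)‖ ∂haarAddCircle ≤ 6 * S + 1 := by
    intro ε
    have h2 := integral_norm_le_of_sidon hm hS0 hS s hs
      (fun n => if hn : n ∈ s then ((ε ⟨n, hn⟩ : ℤ) : ℂ) else 0) (by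
        intro n
        by_cases hn : n ∈ s
        · simp only [hn, dite_true]
          rcases Int.units_eq_one_or (ε ⟨n, hn⟩) with h | h <;> simp [h]
        · simp [hn])
    refine le_trans (le_of_eq ?_) h2
    congr 1; ext x
    rw [← Finset.sum_coe_sort s]
    congr 1
    refine Finset.sum_congr rfl fun n _ => ?_
    simp [mul_assoc]
  have hc : ∀ ε : s → ℤˣ, Integrable (fun x : UnitAddCircle =>
      ‖∑ n : s, ((ε n : ℤ) : ℂ) * (m n * fourier (-(n : ℤ)) x)‖) haarAddCircle := by
    intro ε
    refine Continuous.integrable_of_hasCompactSupport ?_ (HasCompactSupport.of_compactSpace _)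
    fun_prop
  have h3 : ∫ x : UnitAddCircle, (𝔼 ε : s → ℤˣ,
      ‖∑ n : s, ((ε n : ℤ) : ℂ) * (m n * fourier (-(n : ℤ)) x)‖) ∂haarAddCircle ≤ 6 * S + 1 := by
    simp_rw [Fintype.expect_eq_sum_div_card]
    rw [integral_div, integral_finsetSum _ fun ε _ => hc ε, ← Fintype.expect_eq_sum_div_card]
    exact Finset.expect_le Finset.univ_nonempty fun ε _ => h1 ε
  have h4 : √(∑ n ∈ s, ‖m n‖ ^ 2) / 4 ≤ ∫ x : UnitAddCircle, (𝔼 ε : s → ℤˣ,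
      ‖∑ n : s, ((ε n : ℤ) : ℂ) * (m n * fourier (-(n : ℤ)) x)‖) ∂haarAddCircle := by
    have h5 : ∫ _x : UnitAddCircle, √(∑ n ∈ s, ‖m n‖ ^ 2) / 4 ∂haarAddCircle =
        √(∑ n ∈ s, ‖m n‖ ^ 2) / 4 := by simp
    rw [← h5]
    refine integral_mono (integrable_const _) ?_ fun x => ?_
    · simp_rw [Fintype.expect_eq_sum_div_card]
      exact (integrable_finsetSum _ fun ε _ => hc ε).div_const _
    · refine le_trans (le_of_eq ?_) (quarter_sqrt_le_expect_signs_norm Finset.univ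
        fun n : s => m n * fourier (-(n : ℤ)) x)
      simp_rw [norm_mul, norm_fourier_apply, mul_one]
      rw [Finset.sum_coe_sort s fun n => ‖m n‖ ^ 2]
  linarith

theorem norm_invSqrtWeight_sq {n : ℤ} (hn : n ≠ 0) : ‖invSqrtWeight n‖ ^ 2 = 1 / |(n : ℝ)| := by
  rw [invSqrtWeight, if_neg hn, Complex.norm_real, Real.norm_eq_abs, sq_abs, div_pow, one_pow,
    Real.sq_sqrt (abs_nonneg _)]

theorem invSqrtWeight_ne_zero {n : ℤ} (hn : n ≠ 0) : invSqrtWeight n ≠ 0 := by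
  intro h
  have h1 := norm_invSqrtWeight_sq hn
  have h2 : 0 < 1 / |(n : ℝ)| := by positivity
  rw [h, norm_zero] at h1
  linarith

theorem not_isSidonWeight_invSqrtWeight : ¬ IsSidonWeight invSqrtWeight := by
  rintro ⟨S, hS0, hS⟩
  obtain ⟨N, hN⟩ := ((Real.tendsto_sum_range_one_div_nat_succ_atTop).eventually_gt_atTop
    ((4 * (6 * S + 1)) ^ 2)).exists
  have hinj : Set.InjOn (fun i : ℕ => (i : ℤ) + 1) (Finset.range N) := by
    intro i _ j _ h
    simpa using h
  have h1 := sum_sq_le_of_sidon (fun n => invSqrtWeight_ne_zero) hS0.le hS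
    ((Finset.range N).image fun i : ℕ => (i : ℤ) + 1) (by
      simp only [Finset.mem_image, not_exists, not_and]
      intro i _
      positivity)
  rw [Finset.sum_image hinj] at h1
  have h2 : ∑ i ∈ Finset.range N, ‖invSqrtWeight ((i : ℤ) + 1)‖ ^ 2 =
      ∑ i ∈ Finset.range N, 1 / ((i : ℝ) + 1) := by
    refine Finset.sum_congr rfl fun i _ => ?_
    rw [norm_invSqrtWeight_sq (by positivity)]
    push_cast
    rw [abs_of_nonneg (by positivity)]
  rw [h2, Real.sqrt_le_left (by positivity)] at h1
  linarith

/-! ### Lower bound for suprema of random sums on separated scales -/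

section Chaining

variable {ι : Type*} [Fintype ι] [DecidableEq ι]

theorem expect_signs_abs_le (s : Finset ι) (b : ι → ℝ) :
    𝔼 ε : ι → ℤˣ, |∑ i ∈ s, ((ε i : ℤ) : ℝ) * b i| ≤ √(∑ i ∈ s, b i ^ 2) := by
  refine Real.le_sqrt_of_sq_le ?_
  rw [← expect_signs_sum_sq s b]
  set X : (ι → ℤˣ) → ℝ := fun ε => ∑ i ∈ s, ((ε i : ℤ) : ℝ) * b i
  set A := 𝔼 ε, |X ε| with hA
  have h : (0 : ℝ) ≤ 𝔼 ε, (|X ε| - A) ^ 2 := Finset.expect_nonneg fun ε _ => sq_nonneg _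
  have h1 : 𝔼 ε, (|X ε| - A) ^ 2 = (𝔼 ε, X ε ^ 2) - A ^ 2 := by
    have h2 : ∀ ε, (|X ε| - A) ^ 2 = X ε ^ 2 - 2 * A * |X ε| + A ^ 2 := by
      intro ε; rw [← sq_abs (X ε)]; ring
    simp_rw [h2]
    rw [Finset.expect_add_distrib, Finset.expect_sub_distrib, ← Finset.mul_expect,
      Fintype.expect_const, ← hA]
    ring
  linarith

/-- The average over the signs of the oscillation of a random sum on an interval of length `ρ`. -/
theorem exists_oscillation_bound {b b' : ι → ℝ → ℝ}
    (hb : ∀ i x, HasDerivAt (b i) (b' i x) x) (hb' : ∀ i, Continuous (b' i))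
    (s : Finset ι) {M ρ : ℝ} (hρ : 0 ≤ ρ) (hM0 : 0 ≤ M) (hM : ∀ x, ∑ i ∈ s, b' i x ^ 2 ≤ M ^ 2)
    (x : ℝ) :
    ∃ O : (ι → ℤˣ) → ℝ, 𝔼 ε, O ε ≤ ρ * M ∧ ∀ ε, ∀ y ∈ Set.Icc x (x + ρ),
      ∑ i ∈ s, ((ε i : ℤ) : ℝ) * b i x ≤ ∑ i ∈ s, ((ε i : ℤ) : ℝ) * b i y + O ε := by
  have hc : ∀ ε : ι → ℤˣ, Continuous fun t => ∑ i ∈ s, ((ε i : ℤ) : ℝ) * b' i t := fun ε =>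
    continuous_finsetSum _ fun i _ => continuous_const.mul (hb' i)
  -- The oscillation is at most the total variation, whose average is controlled pointwise in `t` by
  -- the second moment.
  refine ⟨fun ε => ∫ t in x..x + ρ, |∑ i ∈ s, ((ε i : ℤ) : ℝ) * b' i t|, ?_, ?_⟩
  · simp_rw [Fintype.expect_eq_sum_div_card]
    rw [← intervalIntegral.integral_finsetSum fun ε _ => (hc ε).abs.intervalIntegrable _ _,
      ← intervalIntegral.integral_div]
    have h1 : ∫ _t in x..x + ρ, M = ρ * M := by simp
    rw [← h1]
    refine intervalIntegral.integral_mono_on (by linarith) ?_ (by simp) fun t _ => ?_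
    · exact ((continuous_finsetSum _ fun ε _ => (hc ε).abs).div_const _).intervalIntegrable _ _
    · rw [← Fintype.expect_eq_sum_div_card]
      exact (expect_signs_abs_le s fun i => b' i t).trans (Real.sqrt_le_iff.2 ⟨hM0, hM t⟩)
  · rintro ε y ⟨hxy, hyx⟩
    have h1 : ∫ t in x..y, ∑ i ∈ s, ((ε i : ℤ) : ℝ) * b' i t =
        ∑ i ∈ s, ((ε i : ℤ) : ℝ) * b i y - ∑ i ∈ s, ((ε i : ℤ) : ℝ) * b i x :=
      intervalIntegral.integral_eq_sub_of_hasDerivAt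
        (fun t _ => HasDerivAt.fun_sum fun i _ => (hb i t).const_mul _)
        ((hc ε).intervalIntegrable _ _)
    have h2 := intervalIntegral.abs_integral_le_integral_abs (μ := volume) (a := x) (b := y)
      (f := fun t => ∑ i ∈ s, ((ε i : ℤ) : ℝ) * b' i t) hxy
    have h3 : ∫ t in x..y, |∑ i ∈ s, ((ε i : ℤ) : ℝ) * b' i t| ≤
        ∫ t in x..x + ρ, |∑ i ∈ s, ((ε i : ℤ) : ℝ) * b' i t| :=
      intervalIntegral.integral_mono_interval le_rfl hxy hyx
        (Filter.Eventually.of_forall fun t => abs_nonneg _) ((hc ε).abs.intervalIntegrable _ _)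
    rw [h1] at h2
    have := neg_abs_le (∑ i ∈ s, ((ε i : ℤ) : ℝ) * b i y - ∑ i ∈ s, ((ε i : ℤ) : ℝ) * b i x)
    simp only
    linarith

/-- Write `max(u, v) = (u + v + |v - u|)/2`. The linear terms average to zero, and Khinchine bounds
the last one from below. -/
theorem quarter_le_expect_max {b : ι → ℝ → ℝ} (s : Finset ι) {x y σ : ℝ}
    (h : σ ^ 2 ≤ ∑ i ∈ s, (b i y - b i x) ^ 2) :
    σ / 4 ≤ 𝔼 ε : ι → ℤˣ, max (∑ i ∈ s, ((ε i : ℤ) : ℝ) * b i x)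
      (∑ i ∈ s, ((ε i : ℤ) : ℝ) * b i y) := by
  have h1 := half_sqrt_le_expect_signs_abs s fun i => b i y - b i x
  have h2 : σ ≤ √(∑ i ∈ s, (b i y - b i x) ^ 2) := Real.le_sqrt_of_sq_le h
  have h3 : 𝔼 ε : ι → ℤˣ, max (∑ i ∈ s, ((ε i : ℤ) : ℝ) * b i x)
      (∑ i ∈ s, ((ε i : ℤ) : ℝ) * b i y) = (𝔼 ε : ι → ℤˣ,
        |∑ i ∈ s, ((ε i : ℤ) : ℝ) * (b i y - b i x)|) / 2 := by
    have h4 : ∀ ε : ι → ℤˣ, max (∑ i ∈ s, ((ε i : ℤ) : ℝ) * b i x)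
        (∑ i ∈ s, ((ε i : ℤ) : ℝ) * b i y) = (∑ i ∈ s, ((ε i : ℤ) : ℝ) * b i x) / 2 +
        (∑ i ∈ s, ((ε i : ℤ) : ℝ) * b i y) / 2 +
        |∑ i ∈ s, ((ε i : ℤ) : ℝ) * (b i y - b i x)| / 2 := by
      intro ε
      simp_rw [mul_sub, Finset.sum_sub_distrib]
      rcases le_total (∑ i ∈ s, ((ε i : ℤ) : ℝ) * b i x) (∑ i ∈ s, ((ε i : ℤ) : ℝ) * b i y)
        with hle | hle
      · rw [max_eq_right hle, abs_of_nonneg (by linarith)]; ring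
      · rw [max_eq_left hle, abs_of_nonpos (by linarith)]; ring
    simp_rw [h4]
    rw [Finset.expect_add_distrib, Finset.expect_add_distrib, ← Finset.expect_div,
      ← Finset.expect_div, ← Finset.expect_div, expect_signs_sum, expect_signs_sum]
    ring
  rw [h3]
  linarith

/-- Lower bound for the average supremum of a random sum whose blocks `B k` live on separated
scales: on each interval of length `ρ k` one chooses greedily between the two subintervals of length
`ρ (k + 1)` starting at `x` and `x + h k`. -/
theorem sum_le_expect_of_separated_blocks {b b' : ι → ℝ → ℝ}
    (hb : ∀ i x, HasDerivAt (b i) (b' i x) x) (hb' : ∀ i, Continuous (b' i))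
    (B : ℕ → Finset ι) (hB : Pairwise fun j k => Disjoint (B j) (B k))
    (σ ρ h D : ℕ → ℝ) (hσ : ∀ k, 0 ≤ σ k) (hρ : ∀ k, 0 ≤ ρ k) (hh : ∀ k, 0 ≤ h k)
    (hD : ∀ k, 0 ≤ D k)
    (hlow : ∀ k x, σ k ^ 2 ≤ ∑ i ∈ B k, (b i (x + h k) - b i x) ^ 2)
    (hup : ∀ k x, ∑ i ∈ B k, b' i x ^ 2 ≤ (D k * σ k) ^ 2)
    (hρD : ∀ k, ρ (k + 1) * D k ≤ 1 / 16) (hhρ : ∀ k, h k + ρ (k + 1) ≤ ρ k)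
    (n k : ℕ) (x : ℝ) (H : (ι → ℤˣ) → ℝ)
    (hH : ∀ ε, ∀ y ∈ Set.Icc x (x + ρ k),
      ∑ j ∈ Finset.Ico k (k + n), ∑ i ∈ B j, ((ε i : ℤ) : ℝ) * b i y ≤ H ε) :
    (∑ j ∈ Finset.Ico k (k + n), σ j) / 8 ≤ 𝔼 ε, H ε := by
  induction n generalizing k x H with
  | zero =>
    simp only [add_zero, Finset.Ico_self, Finset.sum_empty, zero_div] at hH ⊢
    exact Finset.expect_nonneg fun ε _ => hH ε x ⟨le_rfl, by linarith [hρ k]⟩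
  | succ n ih =>
    have hIco : Finset.Ico k (k + (n + 1)) = insert k (Finset.Ico (k + 1) (k + 1 + n)) := by
      ext j; simp only [Finset.mem_insert, Finset.mem_Ico]; omega
    have hk : k ∉ Finset.Ico (k + 1) (k + 1 + n) := by simp
    simp only [hIco, Finset.sum_insert hk] at hH ⊢
    obtain ⟨O, hO, hO'⟩ := exists_oscillation_bound hb hb' (B k) (hρ (k + 1))
      (mul_nonneg (hD k) (hσ k)) (hup k) x
    obtain ⟨P, hP, hP'⟩ := exists_oscillation_bound hb hb' (B k) (hρ (k + 1))
      (mul_nonneg (hD k) (hσ k)) (hup k) (x + h k)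
    have hO0 : ∀ ε, 0 ≤ O ε := fun ε => by
      have := hO' ε x ⟨le_rfl, by linarith [hρ (k + 1)]⟩
      linarith
    have hP0 : ∀ ε, 0 ≤ P ε := fun ε => by
      have := hP' ε (x + h k) ⟨le_rfl, by linarith [hρ (k + 1)]⟩
      linarith
    set X : (ι → ℤˣ) → ℝ → ℝ := fun ε y => ∑ i ∈ B k, ((ε i : ℤ) : ℝ) * b i y with hX
    have hpw1 : ∀ (ε ε' : ι → ℤˣ) y, X ((B k).piecewise ε ε') y = X ε y := by
      intro ε ε' y
      refine Finset.sum_congr rfl fun i hi => ?_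
      rw [Finset.piecewise_eq_of_mem _ _ _ hi]
    have hpw2 : ∀ (ε ε' : ι → ℤˣ) y, ∑ j ∈ Finset.Ico (k + 1) (k + 1 + n), ∑ i ∈ B j,
        (((B k).piecewise ε ε' i : ℤ) : ℝ) * b i y =
        ∑ j ∈ Finset.Ico (k + 1) (k + 1 + n), ∑ i ∈ B j, ((ε' i : ℤ) : ℝ) * b i y := by
      intro ε ε' y
      refine Finset.sum_congr rfl fun j hj => Finset.sum_congr rfl fun i hi => ?_
      have hjk : j ≠ k := fun h0 => hk (h0 ▸ hj)
      rw [Finset.piecewise_eq_of_notMem _ _ _ (Finset.disjoint_left.1 (hB hjk) hi)]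
    -- Fix the signs of block `k` and average over the others. The better of the two subintervals is
    -- then determined, and the induction hypothesis applies on it to the finer blocks. Both
    -- oscillations are subtracted so that the bound has one form for either choice.
    have hstep : ∀ ε : ι → ℤˣ, max (X ε x) (X ε (x + h k)) - (O ε + P ε) +
        (∑ j ∈ Finset.Ico (k + 1) (k + 1 + n), σ j) / 8 ≤
        𝔼 ε' : ι → ℤˣ, H ((B k).piecewise ε ε') := by
      intro ε
      have hsub : ∀ x₀ Q, x ≤ x₀ → x₀ + ρ (k + 1) ≤ x + ρ k →
          (∀ y ∈ Set.Icc x₀ (x₀ + ρ (k + 1)), X ε x₀ ≤ X ε y + Q) →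
          X ε x₀ - Q + (∑ j ∈ Finset.Ico (k + 1) (k + 1 + n), σ j) / 8 ≤
            𝔼 ε' : ι → ℤˣ, H ((B k).piecewise ε ε') := by
        intro x₀ Q h1 h2 h3
        have h4 := ih (k + 1) x₀ (fun ε' => H ((B k).piecewise ε ε') - (X ε x₀ - Q)) (by
          rintro ε' y hy
          have h5 := hH ((B k).piecewise ε ε') y ⟨h1.trans hy.1, hy.2.trans h2⟩
          rw [hpw2] at h5
          have h6 := hpw1 ε ε' y
          simp only [hX] at h6
          rw [h6] at h5
          have h7 := h3 y hy
          simp only [hX] at h7 ⊢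
          linarith)
        rw [Finset.expect_sub_distrib, Fintype.expect_const] at h4
        linarith
      rcases le_total (X ε x) (X ε (x + h k)) with hle | hle
      · rw [max_eq_right hle]
        have := hsub (x + h k) (P ε) (by linarith [hh k]) (by linarith [hhρ k]) (hP' ε)
        linarith [hO0 ε]
      · rw [max_eq_left hle]
        have := hsub x (O ε) le_rfl (by linarith [hhρ k, hh k]) (hO' ε)
        linarith [hP0 ε]
    have hfin := Finset.expect_le_expect (s := (Finset.univ : Finset (ι → ℤˣ)))
      fun ε _ => hstep ε
    rw [expect_signs_piecewise, Finset.expect_add_distrib, Finset.expect_sub_distrib,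
      Finset.expect_add_distrib, Fintype.expect_const] at hfin
    -- The net gain from block `k` is at least `σ k / 4 - 2 · σ k / 16 = σ k / 8`.
    have hmax := quarter_le_expect_max (B k) (hlow k x)
    have hosc : ρ (k + 1) * (D k * σ k) ≤ σ k / 16 := by
      nlinarith [mul_le_mul_of_nonneg_right (hρD k) (hσ k)]
    simp only [hX] at hfin
    linarith

end Chaining

/-! ### Random trigonometric polynomials and dyadic blocks -/

theorem expect_signs_comp_inl {α β : Type*} [Fintype α] [DecidableEq α] [Fintype β] [DecidableEq β]
    (G : (α → ℤˣ) → ℝ) : 𝔼 ω : α ⊕ β → ℤˣ, G (ω ∘ Sum.inl) = 𝔼 ε, G ε := by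
  rw [Fintype.expect_equiv (Equiv.sumArrowEquivProdArrow α β ℤˣ) (fun ω => G (ω ∘ Sum.inl))
    (fun p => G p.1) fun ω => rfl, ← Finset.univ_product_univ, Finset.expect_product]
  simp

theorem expect_signs_comp_inr {α β : Type*} [Fintype α] [DecidableEq α] [Fintype β] [DecidableEq β]
    (G : (β → ℤˣ) → ℝ) : 𝔼 ω : α ⊕ β → ℤˣ, G (ω ∘ Sum.inr) = 𝔼 ε, G ε := by
  rw [Fintype.expect_equiv (Equiv.sumArrowEquivProdArrow α β ℤˣ) (fun ω => G (ω ∘ Sum.inr))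
    (fun p => G p.2) fun ω => rfl, ← Finset.univ_product_univ, Finset.expect_product]
  simp

theorem sum_range_sum_filter_eq {S : Type*} [Fintype S] (l : S → ℕ) {K r : ℕ}
    (hK : ∀ n, l n / 7 < K) (hr : r < 7) (φ : S → ℝ) :
    ∑ j ∈ Finset.range K, ∑ n with l n = 7 * j + r, φ n = ∑ n, if l n % 7 = r then φ n else 0 := by
  simp_rw [Finset.sum_filter]
  rw [Finset.sum_comm]
  refine Finset.sum_congr rfl fun n _ => ?_
  by_cases h : l n % 7 = r
  · have h1 : ∀ j, l n = 7 * j + r ↔ l n / 7 = j := by intro j; omega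
    simp only [h1, Finset.sum_ite_eq, Finset.mem_range, hK n, h, if_true]
  · have h1 : ∀ j, ¬ l n = 7 * j + r := by intro j; omega
    simp [h1, h]

/-- The supremum norm of the trigonometric polynomial with coefficients `ε n * a n`. -/
noncomputable def signedNorm (a : ℤ →₀ ℂ) (ε : a.support → ℤˣ) : ℝ :=
  ‖∑ n : a.support, (((ε n : ℤ) : ℂ) * a n) • (fourier (n : ℤ) : C(UnitAddCircle, ℂ))‖

theorem rademacherNorm_eq_expect (a : ℤ →₀ ℂ) : rademacherNorm a = 𝔼 ε, signedNorm a ε := by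
  rw [Fintype.expect_eq_sum_div_card, rademacherNorm]
  simp [signedNorm, Fintype.card_units_int]

/-- Real and imaginary part of `a(n) e^{2πinx}`. -/
noncomputable def realPartTerm (a : ℤ →₀ ℂ) : a.support ⊕ a.support → ℝ → ℝ
  | Sum.inl n => fun x => (a n).re * Real.cos (2 * Real.pi * n * x) -
      (a n).im * Real.sin (2 * Real.pi * n * x)
  | Sum.inr n => fun x => (a n).re * Real.sin (2 * Real.pi * n * x) +
      (a n).im * Real.cos (2 * Real.pi * n * x)

/-- The derivatives of `realPartTerm`. -/
noncomputable def realPartTermDeriv (a : ℤ →₀ ℂ) : a.support ⊕ a.support → ℝ → ℝ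
  | Sum.inl n => fun x => -(2 * Real.pi * n) * realPartTerm a (Sum.inr n) x
  | Sum.inr n => fun x => (2 * Real.pi * n) * realPartTerm a (Sum.inl n) x

theorem hasDerivAt_realPartTerm (a : ℤ →₀ ℂ) (i : a.support ⊕ a.support) (x : ℝ) :
    HasDerivAt (realPartTerm a i) (realPartTermDeriv a i x) x := by
  have h : ∀ n : ℤ, HasDerivAt (fun x : ℝ => 2 * Real.pi * n * x) (2 * Real.pi * n) x := fun n => by
    simpa using (hasDerivAt_id x).const_mul (2 * Real.pi * (n : ℝ))
  rcases i with n | n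
  · refine (((h n).cos.const_mul (a n).re).sub ((h n).sin.const_mul (a n).im)).congr_deriv ?_
    simp only [realPartTermDeriv, realPartTerm]; ring
  · refine (((h n).sin.const_mul (a n).re).add ((h n).cos.const_mul (a n).im)).congr_deriv ?_
    simp only [realPartTermDeriv, realPartTerm]; ring

theorem continuous_realPartTermDeriv (a : ℤ →₀ ℂ) (i : a.support ⊕ a.support) :
    Continuous (realPartTermDeriv a i) := by
  have h : ∀ j, Continuous (realPartTerm a j) := fun j =>
    continuous_iff_continuousAt.2 fun x => (hasDerivAt_realPartTerm a j x).continuousAt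
  rcases i with n | n
  · exact continuous_const.mul (h _)
  · exact continuous_const.mul (h _)

theorem realPartTermDeriv_sq_add_sq (a : ℤ →₀ ℂ) (n : a.support) (x : ℝ) :
    realPartTermDeriv a (Sum.inl n) x ^ 2 + realPartTermDeriv a (Sum.inr n) x ^ 2 =
      (2 * Real.pi * n) ^ 2 * ‖a n‖ ^ 2 := by
  rw [Complex.sq_norm, Complex.normSq_apply]
  simp only [realPartTermDeriv, realPartTerm]
  linear_combination (2 * Real.pi * n) ^ 2 * ((a n).re ^ 2 + (a n).im ^ 2) *
    Real.sin_sq_add_cos_sq (2 * Real.pi * n * x)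

/-- This is `|a(n)|² |e^{2πinh} - 1|²`. Its independence of `x` is the reason for using real and
imaginary parts together: either part alone may have small increments at some `x`. -/
theorem realPartTerm_increment_sq (a : ℤ →₀ ℂ) (n : a.support) (x h : ℝ) :
    (realPartTerm a (Sum.inl n) (x + h) - realPartTerm a (Sum.inl n) x) ^ 2 +
      (realPartTerm a (Sum.inr n) (x + h) - realPartTerm a (Sum.inr n) x) ^ 2 =
      (2 - 2 * Real.cos (2 * Real.pi * n * h)) * ‖a n‖ ^ 2 := by
  rw [Complex.sq_norm, Complex.normSq_apply]
  simp only [realPartTerm, mul_add, Real.cos_add, Real.sin_add]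
  set c := Real.cos (2 * Real.pi * n * x)
  set s := Real.sin (2 * Real.pi * n * x)
  set C := Real.cos (2 * Real.pi * n * h)
  set T := Real.sin (2 * Real.pi * n * h)
  have h1 : s ^ 2 + c ^ 2 = 1 := Real.sin_sq_add_cos_sq _
  have h2 : T ^ 2 + C ^ 2 = 1 := Real.sin_sq_add_cos_sq _
  linear_combination ((a n).re ^ 2 + (a n).im ^ 2) * ((T ^ 2 + C ^ 2 + 1 - 2 * C) * h1 + h2)

theorem fourier_coe_eq_cos_add_sin (n : ℤ) (x : ℝ) :
    fourier n (x : UnitAddCircle) = ((Real.cos (2 * Real.pi * n * x) : ℝ) : ℂ) +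
      ((Real.sin (2 * Real.pi * n * x) : ℝ) : ℂ) * Complex.I := by
  rw [fourier_coe_apply, Complex.ofReal_cos, Complex.ofReal_sin, ← Complex.exp_mul_I]
  congr 1
  push_cast
  ring

theorem sum_realPartTerm_inl_le (a : ℤ →₀ ℂ) (ε : a.support → ℤˣ) (y : ℝ) :
    ∑ n, ((ε n : ℤ) : ℝ) * realPartTerm a (Sum.inl n) y ≤ signedNorm a ε := by
  refine le_trans (le_of_eq ?_) ((Complex.re_le_norm _).trans
    (ContinuousMap.norm_coe_le_norm _ (y : UnitAddCircle)))
  simp only [ContinuousMap.sum_apply, ContinuousMap.smul_apply, smul_eq_mul, Complex.re_sum,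
    fourier_coe_eq_cos_add_sin]
  refine Finset.sum_congr rfl fun n _ => ?_
  simp [realPartTerm, -Complex.ofReal_cos, -Complex.ofReal_sin]
  ring

theorem sum_realPartTerm_inr_le (a : ℤ →₀ ℂ) (ε : a.support → ℤˣ) (y : ℝ) :
    ∑ n, ((ε n : ℤ) : ℝ) * realPartTerm a (Sum.inr n) y ≤ signedNorm a ε := by
  refine le_trans (le_of_eq ?_) (((le_abs_self _).trans (Complex.abs_im_le_norm _)).trans
    (ContinuousMap.norm_coe_le_norm _ (y : UnitAddCircle)))
  simp only [ContinuousMap.sum_apply, ContinuousMap.smul_apply, smul_eq_mul, Complex.im_sum,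
    fourier_coe_eq_cos_add_sin]
  refine Finset.sum_congr rfl fun n _ => ?_
  simp [realPartTerm, -Complex.ofReal_cos, -Complex.ofReal_sin]
  ring

theorem log_bounds {n : ℤ} (hn : n ≠ 0) :
    (2 : ℝ) ^ Nat.log 2 n.natAbs ≤ |(n : ℝ)| ∧ |(n : ℝ)| < 2 ^ (Nat.log 2 n.natAbs + 1) := by
  have h : |(n : ℝ)| = (n.natAbs : ℝ) := by rw [Nat.cast_natAbs]; push_cast; rfl
  rw [h]
  exact ⟨by exact_mod_cast Nat.pow_log_le_self 2 (Int.natAbs_ne_zero.2 hn),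
    by exact_mod_cast Nat.lt_pow_succ_log_self one_lt_two _⟩

/-- The frequencies of `a` in the dyadic block `2 ^ q ≤ |n| < 2 ^ (q + 1)`. -/
def dyadicBlock (a : ℤ →₀ ℂ) (q : ℕ) : Finset a.support :=
  Finset.univ.filter fun n => Nat.log 2 (n : ℤ).natAbs = q

/-- Average the bound over the given signs and those flipped off `p`; the unwanted terms cancel.
Hence restricting the spectrum does not increase the average norm. -/
theorem signs_filter_sum_le {S : Type*} [Fintype S] (p : S → Prop) [DecidablePred p]
    (N : (S → ℤˣ) → ℝ) (β : S → ℝ) (hN : ∀ ε : S → ℤˣ, ∑ n, ((ε n : ℤ) : ℝ) * β n ≤ N ε)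
    (ε : S → ℤˣ) :
    ∑ n, (if p n then ((ε n : ℤ) : ℝ) * β n else 0) ≤
      (N ε + N (ε * fun n => if p n then 1 else -1)) / 2 := by
  have h1 := add_le_add (hN ε) (hN (ε * fun n => if p n then 1 else -1))
  rw [← Finset.sum_add_distrib] at h1
  refine le_trans (le_of_eq ?_) (div_le_div_of_nonneg_right h1 zero_le_two)
  rw [Finset.sum_div]
  refine Finset.sum_congr rfl fun n _ => ?_
  by_cases h : p n <;> simp [h]

/-- The block theorem is applied to real and imaginary parts carrying independent families of signs.
Each family is dominated by a sup norm with average `[|f|]`, so the total is `2[|f|]`, and the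
factor `1/8` turns this into `16`. -/
theorem sum_dyadicBlock_le_rademacherNorm (a : ℤ →₀ ℂ) (ha : (0 : ℤ) ∉ a.support) {r K : ℕ}
    (hr : r < 7) (hK : ∀ n : a.support, Nat.log 2 (n : ℤ).natAbs / 7 < K) :
    ∑ j ∈ Finset.range K, √(∑ n ∈ dyadicBlock a (7 * j + r), ‖a n‖ ^ 2) ≤
      16 * rademacherNorm a := by
  have hne : ∀ n : a.support, (n : ℤ) ≠ 0 := fun n h => ha (h ▸ n.2)
  set σ : ℕ → ℝ := fun j => √(∑ n ∈ dyadicBlock a (7 * j + r), ‖a n‖ ^ 2) with hσdef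
  have hσ2 : ∀ j, σ j ^ 2 = ∑ n ∈ dyadicBlock a (7 * j + r), ‖a n‖ ^ 2 := fun j =>
    Real.sq_sqrt (Finset.sum_nonneg fun n _ => sq_nonneg _)
  have hmem : ∀ {q} {n : a.support}, n ∈ dyadicBlock a q → Nat.log 2 (n : ℤ).natAbs = q := by
    intro q n h; simpa [dyadicBlock] using h
  set p : a.support → Prop := fun n => Nat.log 2 (n : ℤ).natAbs % 7 = r with hp
  set δ : a.support → ℤˣ := fun n => if p n then 1 else -1 with hδ
  set H : (a.support ⊕ a.support → ℤˣ) → ℝ := fun ω =>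
    (signedNorm a (ω ∘ Sum.inl) + signedNorm a (ω ∘ Sum.inl * δ)) / 2 +
    (signedNorm a (ω ∘ Sum.inr) + signedNorm a (ω ∘ Sum.inr * δ)) / 2 with hHdef
  have hEH : 𝔼 ω, H ω = 2 * rademacherNorm a := by
    simp only [hHdef]
    rw [Finset.expect_add_distrib, ← Finset.expect_div, ← Finset.expect_div,
      Finset.expect_add_distrib, Finset.expect_add_distrib, expect_signs_comp_inl,
      expect_signs_comp_inr, expect_signs_comp_inl (fun ε => signedNorm a (ε * δ)),
      expect_signs_comp_inr (fun ε => signedNorm a (ε * δ)), expect_signs_mul_right,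
      ← rademacherNorm_eq_expect]
    ring
  have main := sum_le_expect_of_separated_blocks (hasDerivAt_realPartTerm a)
    (continuous_realPartTermDeriv a)
    (fun j => (dyadicBlock a (7 * j + r)).disjSum (dyadicBlock a (7 * j + r)))
    (by
      intro j k hjk
      refine Finset.disjoint_left.2 fun i hi hi' => ?_
      rcases i with n | n
      · rw [Finset.inl_mem_disjSum] at hi hi'
        have := hmem hi; have := hmem hi'; omega
      · rw [Finset.inr_mem_disjSum] at hi hi'
        have := hmem hi; have := hmem hi'; omega)
    -- With `q = 7k + r`, the shift `2^{-q-2}` puts `2π|n|h` in `[π/2, π]`, so the cosine is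
    -- nonpositive. The derivative factor is `2^{q+4} = 8 · 2^{q+1} ≥ 2π|n|`. The gap 7 makes `ρ
    -- (k+1) * D k = 2^{-q-8} · 2^{q+4} = 1/16` exactly.
    σ (fun k => (1 / 2) ^ (7 * k + r + 1)) (fun k => (1 / 2) ^ (7 * k + r + 2))
    (fun k => 2 ^ (7 * k + r + 4)) (fun k => Real.sqrt_nonneg _) (fun k => by positivity)
    (fun k => by positivity) (fun k => by positivity)
    (by
      intro k x
      rw [hσ2, Finset.sum_disjSum, ← Finset.sum_add_distrib]
      refine Finset.sum_le_sum fun n hn => ?_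
      rw [realPartTerm_increment_sq]
      obtain ⟨h1, h2⟩ := log_bounds (hne n)
      rw [hmem hn] at h1 h2
      generalize 7 * k + r = q at h1 h2 ⊢
      have hcos : Real.cos (2 * Real.pi * n * (1 / 2) ^ (q + 2)) ≤ 0 := by
        rw [← Real.cos_abs]
        have h3 : |2 * Real.pi * n * (1 / 2 : ℝ) ^ (q + 2)| =
            2 * Real.pi * (|(n : ℝ)| * (1 / 2) ^ (q + 2)) := by
          rw [abs_mul, abs_mul, abs_of_pos Real.two_pi_pos,
            abs_of_pos (by positivity : (0 : ℝ) < (1 / 2) ^ (q + 2))]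
          ring
        have h4 : (2 : ℝ) ^ q * (1 / 2) ^ (q + 2) = 1 / 4 := by
          rw [pow_add, ← mul_assoc, ← mul_pow]; norm_num
        have h5 : (2 : ℝ) ^ (q + 1) * (1 / 2) ^ (q + 2) = 1 / 2 := by
          rw [pow_succ (1 / 2 : ℝ) (q + 1), ← mul_assoc, ← mul_pow]; norm_num
        have h6 := mul_le_mul_of_nonneg_right h1 (by positivity : (0 : ℝ) ≤ (1 / 2) ^ (q + 2))
        have h7 := mul_le_mul_of_nonneg_right h2.le (by positivity : (0 : ℝ) ≤ (1 / 2) ^ (q + 2))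
        rw [h4] at h6
        rw [h5] at h7
        rw [h3]
        have := Real.pi_pos
        exact Real.cos_nonpos_of_pi_div_two_le_of_le (by nlinarith) (by nlinarith)
      nlinarith [sq_nonneg ‖a n‖])
    (by
      intro k x
      rw [mul_pow, hσ2, Finset.sum_disjSum, ← Finset.sum_add_distrib, Finset.mul_sum]
      refine Finset.sum_le_sum fun n hn => ?_
      rw [realPartTermDeriv_sq_add_sq]
      refine mul_le_mul_of_nonneg_right ?_ (sq_nonneg _)
      obtain ⟨h1, h2⟩ := log_bounds (hne n)
      rw [hmem hn] at h1 h2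
      refine sq_le_sq' ?_ ?_ <;>
      · have h3 : (2 : ℝ) ^ (7 * k + r + 4) = 8 * 2 ^ (7 * k + r + 1) := by ring
        have h4 := abs_le.1 h2.le
        have := Real.pi_pos
        have := Real.pi_lt_four
        have : (0 : ℝ) < 2 ^ (7 * k + r + 1) := by positivity
        rw [h3]
        nlinarith)
    (by
      intro k
      have : (1 / 2 : ℝ) ^ (7 * (k + 1) + r + 1) * 2 ^ (7 * k + r + 4) = 1 / 16 := by
        rw [show 7 * (k + 1) + r + 1 = (7 * k + r + 4) + 4 by ring, pow_add, mul_right_comm,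
          ← mul_pow]
        norm_num
      exact this.le)
    (by
      intro k
      have h1 : (1 / 2 : ℝ) ^ (7 * (k + 1) + r + 1) = (1 / 2) ^ (7 * k + r + 1) * (1 / 128) := by
        rw [show 7 * (k + 1) + r + 1 = (7 * k + r + 1) + 7 by ring, pow_add]; norm_num
      have h2 : (1 / 2 : ℝ) ^ (7 * k + r + 2) = (1 / 2) ^ (7 * k + r + 1) * (1 / 2) := by ring
      have : (0 : ℝ) < (1 / 2) ^ (7 * k + r + 1) := by positivity
      rw [h1, h2]
      linarith)
    K 0 0 H (by
      intro ω y _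
      have e1 := signs_filter_sum_le p (signedNorm a) (fun n => realPartTerm a (Sum.inl n) y)
        (fun ε => sum_realPartTerm_inl_le a ε y) (ω ∘ Sum.inl)
      have e2 := signs_filter_sum_le p (signedNorm a) (fun n => realPartTerm a (Sum.inr n) y)
        (fun ε => sum_realPartTerm_inr_le a ε y) (ω ∘ Sum.inr)
      simp only [hp] at e1 e2
      rw [← sum_range_sum_filter_eq (fun n : a.support => Nat.log 2 (n : ℤ).natAbs) hK hr]
        at e1 e2
      refine le_trans (le_of_eq ?_) (add_le_add e1 e2)
      rw [← Finset.sum_add_distrib, zero_add, Finset.range_eq_Ico]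
      refine Finset.sum_congr rfl fun j _ => ?_
      rw [Finset.sum_disjSum]
      rfl)
  rw [hEH, zero_add, ← Finset.range_eq_Ico] at main
  linarith

/-! ### The weighted Rider condition -/

theorem sum_dyadicBlock_inv_le (a : ℤ →₀ ℂ) (ha : (0 : ℤ) ∉ a.support) (q : ℕ) :
    ∑ n ∈ dyadicBlock a q, ‖invSqrtWeight n‖ ^ 2 ≤ 4 := by
  have hne : ∀ n : a.support, (n : ℤ) ≠ 0 := fun n h => ha (h ▸ n.2)
  have hcard : ((dyadicBlock a q).card : ℝ) ≤ 4 * 2 ^ q := by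
    have h1 : (dyadicBlock a q).card ≤ (Finset.Ioo (-(2 : ℤ) ^ (q + 1)) (2 ^ (q + 1))).card := by
      refine Finset.card_le_card_of_injOn (fun n => (n : ℤ)) ?_ (Subtype.val_injective.injOn)
      intro n hn
      have h2 := (log_bounds (hne n)).2
      have h3 : Nat.log 2 (n : ℤ).natAbs = q := by simpa [dyadicBlock] using hn
      rw [h3, abs_lt] at h2
      simp only [Finset.coe_Ioo, Set.mem_Ioo]
      exact ⟨by exact_mod_cast h2.1, by exact_mod_cast h2.2⟩
    rw [Int.card_Ioo] at h1
    have h4 : ((2 : ℤ) ^ (q + 1) - -2 ^ (q + 1) - 1).toNat ≤ 4 * 2 ^ q := by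
      rw [Int.toNat_le]; push_cast; ring_nf; omega
    exact_mod_cast h1.trans h4
  calc _ ≤ ∑ n ∈ dyadicBlock a q, 1 / (2 : ℝ) ^ q := by
        refine Finset.sum_le_sum fun n hn => ?_
        rw [norm_invSqrtWeight_sq (hne n)]
        have h2 := (log_bounds (hne n)).1
        have h3 : Nat.log 2 (n : ℤ).natAbs = q := by simpa [dyadicBlock] using hn
        rw [h3] at h2
        exact one_div_le_one_div_of_le (by positivity) h2
    _ = (dyadicBlock a q).card / 2 ^ q := by
        rw [Finset.sum_const, nsmul_eq_mul, mul_one_div]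
    _ ≤ 4 := by rwa [div_le_iff₀ (by positivity)]

theorem satisfiesRider_invSqrtWeight : SatisfiesRider invSqrtWeight := by
  -- `224 = 7 · 2 · 16`: seven residue classes, Cauchy–Schwarz with block sums at most `4`, and the
  -- block bound.
  refine ⟨224, by norm_num, fun a ha => ?_⟩
  have ha0 : (0 : ℤ) ∉ a.support := fun h => by
    have := ha h
    simp [invSqrtWeight] at this
  obtain ⟨K, hK⟩ : ∃ K, ∀ n : a.support, Nat.log 2 (n : ℤ).natAbs / 7 < K := by
    refine ⟨Finset.univ.sup (fun n : a.support => Nat.log 2 (n : ℤ).natAbs / 7) + 1, fun n => ?_⟩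
    exact Nat.lt_succ_of_le (Finset.le_sup (f := fun n : a.support =>
      Nat.log 2 (n : ℤ).natAbs / 7) (Finset.mem_univ n))
  have hblock : ∀ q, ∑ n ∈ dyadicBlock a q, ‖invSqrtWeight n * a n‖ ≤
      2 * √(∑ n ∈ dyadicBlock a q, ‖a n‖ ^ 2) := by
    intro q
    simp_rw [norm_mul]
    refine (Real.sum_mul_le_sqrt_mul_sqrt _ _ _).trans
      (mul_le_mul_of_nonneg_right ?_ (Real.sqrt_nonneg _))
    rw [Real.sqrt_le_left zero_le_two]
    exact (sum_dyadicBlock_inv_le a ha0 q).trans (by norm_num)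
  have hclass : ∀ r ∈ Finset.range 7, ∑ n : a.support,
      (if Nat.log 2 (n : ℤ).natAbs % 7 = r then ‖invSqrtWeight n * a n‖ else 0) ≤
      32 * rademacherNorm a := by
    intro r hr
    rw [← sum_range_sum_filter_eq (fun n : a.support => Nat.log 2 (n : ℤ).natAbs) hK
      (Finset.mem_range.1 hr)]
    have h1 := sum_dyadicBlock_le_rademacherNorm a ha0 (Finset.mem_range.1 hr) hK
    have h2 : ∑ j ∈ Finset.range K, ∑ n ∈ dyadicBlock a (7 * j + r), ‖invSqrtWeight n * a n‖ ≤
        ∑ j ∈ Finset.range K, 2 * √(∑ n ∈ dyadicBlock a (7 * j + r), ‖a n‖ ^ 2) :=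
      Finset.sum_le_sum fun j _ => hblock _
    rw [← Finset.mul_sum] at h2
    simp only [dyadicBlock] at h1 h2 ⊢
    linarith
  have h3 := Finset.sum_le_sum hclass
  rw [Finset.sum_comm] at h3
  have h4 : ∀ n : a.support, ∑ r ∈ Finset.range 7,
      (if Nat.log 2 (n : ℤ).natAbs % 7 = r then ‖invSqrtWeight n * a n‖ else 0) =
      ‖invSqrtWeight n * a n‖ := by
    intro n
    rw [Finset.sum_ite_eq, if_pos (Finset.mem_range.2 (Nat.mod_lt _ (by norm_num)))]
  simp_rw [h4] at h3
  rw [Finset.sum_coe_sort a.support fun n => ‖invSqrtWeight n * a n‖, Finset.sum_const,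
    Finset.card_range, nsmul_eq_mul] at h3
  push_cast at h3
  linarith

/-! ### Logarithmic energy and the multiplier property -/

/-- Let `u ≤ v`. If `k` exceeds four times the product of the root logarithms, then `log(1 + u) <
k/4`, so `u k ≤ e^{k/4} · 4e^{k/4}`; otherwise the first term suffices. The exponent `k/2` matters:
for a logarithmic `k` it yields an integrable square-root singularity. -/
theorem mul_mul_le_of_sqrt_log {u v k : ℝ} (hu : 0 ≤ u) (hv : 0 ≤ v) (hk : 0 ≤ k) :
    u * v * k ≤ 4 * ((u * Real.log (1 + u) ^ (1 / 2 : ℝ)) * (v * Real.log (1 + v) ^ (1 / 2 : ℝ))) +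
      4 * (u + v) * Real.exp (k / 2) := by
  wlog huv : u ≤ v generalizing u v
  · have := this hv hu (le_of_not_ge huv)
    linarith
  have hlu : 0 ≤ Real.log (1 + u) := Real.log_nonneg (by linarith)
  have hlv : 0 ≤ Real.log (1 + v) := Real.log_nonneg (by linarith)
  rw [← Real.sqrt_eq_rpow, ← Real.sqrt_eq_rpow]
  set φ := √(Real.log (1 + u)) with hφ
  set ψ := √(Real.log (1 + v))
  have hφ0 : 0 ≤ φ := Real.sqrt_nonneg _
  have hψ0 : 0 ≤ ψ := Real.sqrt_nonneg _
  have hφψ : φ ≤ ψ := Real.sqrt_le_sqrt (Real.log_le_log (by linarith) (by linarith))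
  rcases le_or_gt k (4 * (φ * ψ)) with h | h
  · have h1 := mul_le_mul_of_nonneg_left h (mul_nonneg hu hv)
    have h2 : 0 ≤ 4 * (u + v) * Real.exp (k / 2) := by positivity
    linarith
  · have h1 : 4 * Real.log (1 + u) < k := by
      rw [← Real.sq_sqrt hlu, ← hφ]
      nlinarith
    have h2 : u ≤ Real.exp (k / 4) := by
      have := (Real.log_le_iff_le_exp (by linarith : 0 < 1 + u)).1 (by linarith : _ ≤ k / 4)
      linarith
    have h3 : k ≤ 4 * Real.exp (k / 4) := by linarith [Real.add_one_le_exp (k / 4)]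
    have h4 : Real.exp (k / 2) = Real.exp (k / 4) * Real.exp (k / 4) := by
      rw [← Real.exp_add]; ring_nf
    have h5 : u * k ≤ Real.exp (k / 4) * (4 * Real.exp (k / 4)) :=
      mul_le_mul h2 h3 hk (Real.exp_pos _).le
    have h6 := mul_le_mul_of_nonneg_right h5 hv
    have h7 : 0 ≤ 4 * ((u * φ) * (v * ψ)) := by positivity
    have h8 : 0 ≤ 4 * u * (Real.exp (k / 4) * Real.exp (k / 4)) := by positivity
    rw [h4]
    linarith

/-- A square-root singularity on the circle dominating `exp (|log (1 - r e^{2πit})| / 2)`. -/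
noncomputable def singularKernel (t : UnitAddCircle) : ℝ :=
  Real.exp (Real.pi / 2) * √(8 / ‖1 - fourier 1 t‖)

/-- The argument contributes at most `π`. For the modulus, `|1 - re| ≥ 1 - r` gives `|1 - e| ≤ 2|1 -
re|`, which makes the bound uniform in `r`. -/
theorem norm_log_one_sub_le {r : ℝ} (hr0 : 0 ≤ r) (hr1 : r < 1) {e : ℂ} (he : ‖e‖ = 1)
    (he1 : e ≠ 1) :
    ‖Complex.log (1 - r * e)‖ ≤ Real.pi + Real.log (8 / ‖1 - e‖) := by
  have hp : 0 < ‖1 - e‖ := norm_pos_iff.2 (sub_ne_zero.2 he1.symm)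
  have hp2 : ‖1 - e‖ ≤ 2 := by
    refine (norm_sub_le _ _).trans ?_
    rw [he, norm_one]; norm_num
  have hre : ‖(r : ℂ) * e‖ = r := by
    rw [norm_mul, he, mul_one, Complex.norm_real, Real.norm_of_nonneg hr0]
  have hw2 : ‖1 - (r : ℂ) * e‖ ≤ 2 := by
    refine (norm_sub_le _ _).trans ?_
    rw [hre, norm_one]; linarith
  have hw1 : 1 - r ≤ ‖1 - (r : ℂ) * e‖ := by
    have := norm_sub_norm_le 1 ((r : ℂ) * e)
    rwa [hre, norm_one] at this
  have hpw : ‖1 - e‖ ≤ 2 * ‖1 - (r : ℂ) * e‖ := by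
    have h1 : 1 - e = (1 - (r : ℂ) * e) - ((1 - r : ℝ) : ℂ) * e := by push_cast; ring
    have h2 : ‖((1 - r : ℝ) : ℂ) * e‖ = 1 - r := by
      rw [norm_mul, he, mul_one, Complex.norm_real, Real.norm_of_nonneg (by linarith)]
    have h3 := norm_sub_le (1 - (r : ℂ) * e) (((1 - r : ℝ) : ℂ) * e)
    rw [← h1, h2] at h3
    linarith
  have hw0 : 0 < ‖1 - (r : ℂ) * e‖ := by linarith
  have hlog : |Real.log ‖1 - (r : ℂ) * e‖| ≤ Real.log (8 / ‖1 - e‖) := by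
    rw [abs_le]
    constructor
    · rw [neg_le, ← Real.log_inv]
      refine Real.log_le_log (inv_pos.2 hw0) ?_
      rw [inv_eq_one_div, div_le_div_iff₀ hw0 hp]
      linarith
    · refine Real.log_le_log hw0 ?_
      rw [le_div_iff₀ hp]
      nlinarith
  refine (Complex.norm_le_abs_re_add_abs_im _).trans ?_
  rw [Complex.log_re, Complex.log_im]
  linarith [Complex.abs_arg_le_pi (1 - (r : ℂ) * e)]

theorem exp_half_log_eq {p : ℝ} (hp : 0 < p) :
    Real.exp ((Real.pi + Real.log (8 / p)) / 2) = Real.exp (Real.pi / 2) * √(8 / p) := by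
  rw [add_div, Real.exp_add, Real.sqrt_eq_rpow, Real.rpow_def_of_pos (by positivity)]
  ring_nf

theorem norm_one_sub_fourier_one (x : ℝ) :
    ‖1 - fourier 1 (x : UnitAddCircle)‖ = 2 * |Real.sin (Real.pi * x)| := by
  have h := Complex.norm_exp_I_mul_ofReal_sub_one (2 * Real.pi * x)
  rw [norm_sub_rev, fourier_coe_apply]
  rw [show 2 * Real.pi * x / 2 = Real.pi * x by ring, norm_mul, Real.norm_two,
    Real.norm_eq_abs] at h
  rw [← h]
  congr 3
  push_cast
  ring

theorem sqrt_eight_div_le {x p : ℝ} (hx : 0 < x) (hp : 4 * x ≤ p) :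
    √(8 / p) ≤ 2 * x ^ (-(1 / 2) : ℝ) := by
  rw [Real.rpow_neg hx.le, ← Real.sqrt_eq_rpow, ← div_eq_mul_inv]
  have h1 : √(8 / p) ≤ √(2 ^ 2 / x) := by
    refine Real.sqrt_le_sqrt ?_
    rw [div_le_div_iff₀ (by linarith) hx]
    linarith
  rwa [Real.sqrt_div (by norm_num) x, Real.sqrt_sq zero_le_two] at h1

theorem measurable_singularKernel : Measurable singularKernel := by
  have : Continuous fun t : UnitAddCircle => ‖1 - fourier 1 t‖ := by fun_prop
  exact ((this.measurable.const_div 8).sqrt).const_mul _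

theorem haar_eq_volume : (haarAddCircle : Measure UnitAddCircle) = volume := by
  rw [volume_eq_smul_haarAddCircle]; simp

/-- On `(0, 1]` the bound `sin(πx) ≥ 2 min(x, 1 - x)` leaves singularities `x^{-1/2}` and `(1 -
x)^{-1/2}` at the two ends. -/
theorem integrable_singularKernel :
    Integrable singularKernel (haarAddCircle : Measure UnitAddCircle) := by
  rw [haar_eq_volume, ← (UnitAddCircle.measurePreserving_mk 0).integrable_comp
    measurable_singularKernel.aestronglyMeasurable]
  have h1 : IntervalIntegrable (fun x : ℝ => x ^ (-(1 / 2) : ℝ)) volume 0 1 :=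
    intervalIntegral.intervalIntegrable_rpow' (by norm_num)
  have h2 : IntervalIntegrable (fun x : ℝ => (1 - x) ^ (-(1 / 2) : ℝ)) volume 0 1 := by
    have := (h1.comp_sub_left 1).symm
    simpa using this
  have h3 := (((intervalIntegrable_iff_integrableOn_Ioc_of_le zero_le_one).1 (h1.add h2)).const_mul
    (Real.exp (Real.pi / 2) * 2))
  rw [zero_add]
  refine Integrable.mono' h3 ?_ ?_
  · refine (measurable_singularKernel.comp ?_).aestronglyMeasurable
    exact AddCircle.measurable_mk'
  · refine (ae_restrict_iff' measurableSet_Ioc).2 (Filter.Eventually.of_forall fun x hx => ?_)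
    have hk : 0 ≤ singularKernel (x : UnitAddCircle) := by unfold singularKernel; positivity
    rw [Function.comp_apply, Real.norm_of_nonneg hk]
    simp only [singularKernel]
    rw [mul_assoc]
    refine mul_le_mul_of_nonneg_left ?_ (Real.exp_pos _).le
    have ha : 0 ≤ x ^ (-(1 / 2) : ℝ) := Real.rpow_nonneg hx.1.le _
    have hb : 0 ≤ (1 - x) ^ (-(1 / 2) : ℝ) := Real.rpow_nonneg (by linarith [hx.2]) _
    rw [norm_one_sub_fourier_one]
    have hpi := Real.pi_pos
    rcases le_or_gt x (1 / 2) with h | h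
    · have hs := Real.mul_le_sin (mul_nonneg hpi.le hx.1.le) (by nlinarith)
      rw [show 2 / Real.pi * (Real.pi * x) = 2 * x by field_simp] at hs
      have := sqrt_eight_div_le hx.1 (p := 2 * |Real.sin (Real.pi * x)|)
        (by linarith [le_abs_self (Real.sin (Real.pi * x))])
      linarith
    -- At `x = 1` the kernel takes the value `0`, by the convention `8 / 0 = 0`.
    · rcases hx.2.eq_or_lt with rfl | hx1
      · simp only [mul_one, Real.sin_pi, abs_zero, mul_zero, div_zero, Real.sqrt_zero]
        linarith
      · have hs := Real.mul_le_sin (x := Real.pi * (1 - x))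
          (mul_nonneg hpi.le (by linarith)) (by nlinarith)
        rw [show 2 / Real.pi * (Real.pi * (1 - x)) = 2 * (1 - x) by field_simp,
          show Real.pi * (1 - x) = Real.pi - Real.pi * x by ring, Real.sin_pi_sub] at hs
        have := sqrt_eight_div_le (by linarith : 0 < 1 - x) (p := 2 * |Real.sin (Real.pi * x)|)
          (by linarith [le_abs_self (Real.sin (Real.pi * x))])
        linarith

theorem singularKernel_sub_comm (x y : UnitAddCircle) :
    singularKernel (x - y) = singularKernel (y - x) := by
  have h : ‖1 - fourier 1 (x - y)‖ = ‖1 - fourier 1 (y - x)‖ := by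
    rw [← neg_sub y x, ← RCLike.norm_conj (1 - fourier 1 (y - x)), map_sub, map_one, ← fourier_neg]
    congr 2
    simp [fourier_apply]
  rw [singularKernel, h, singularKernel]

theorem ae_fourier_one_sub_ne_one : ∀ᵐ p : UnitAddCircle × UnitAddCircle
    ∂(haarAddCircle : Measure UnitAddCircle).prod haarAddCircle, fourier 1 (p.1 - p.2) ≠ 1 := by
  have h0 : ∀ᵐ t : UnitAddCircle ∂haarAddCircle, t ≠ 0 := by
    rw [haar_eq_volume, ae_iff]
    have := AddCircle.volume_closedBall (1 : ℝ) (x := 0) 0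
    simpa using this
  have h1 := (quasiMeasurePreserving_sub (haarAddCircle : Measure UnitAddCircle)
    haarAddCircle).ae h0
  filter_upwards [h1] with p hp h
  refine hp (AddCircle.injective_toCircle one_ne_zero ?_)
  rw [fourier_one] at h
  ext
  simpa using h

theorem integrable_of_mem_LLog_half {f : UnitAddCircle → ℂ} (hf : f ∈ LLog (1 / 2)) :
    Integrable f haarAddCircle := by
  refine Integrable.mono' ((integrable_const (Real.exp 1)).add hf.2) hf.1
    (Filter.Eventually.of_forall fun x => ?_)
  have h0 : 0 ≤ Real.log (1 + ‖f x‖) := Real.log_nonneg (by linarith [norm_nonneg (f x)])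
  have h1 : 0 ≤ Real.log (1 + ‖f x‖) ^ (1 / 2 : ℝ) := Real.rpow_nonneg h0 _
  simp only [Pi.add_apply]
  rcases le_or_gt ‖f x‖ (Real.exp 1) with h | h
  · nlinarith [norm_nonneg (f x)]
  · have h2 : 1 ≤ Real.log (1 + ‖f x‖) :=
      (Real.le_log_iff_exp_le (by linarith [norm_nonneg (f x)])).2 (by linarith)
    have h3 : 1 ≤ Real.log (1 + ‖f x‖) ^ (1 / 2 : ℝ) := Real.one_le_rpow h2 (by norm_num)
    nlinarith [norm_nonneg (f x), Real.exp_pos 1]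

/-- The dominating function of the logarithmic energy of `f`. -/
noncomputable def energyBound (f : UnitAddCircle → ℂ) (p : UnitAddCircle × UnitAddCircle) : ℝ :=
  4 * ((‖f p.1‖ * Real.log (1 + ‖f p.1‖) ^ (1 / 2 : ℝ)) *
    (‖f p.2‖ * Real.log (1 + ‖f p.2‖) ^ (1 / 2 : ℝ))) +
    4 * (‖f p.1‖ + ‖f p.2‖) * singularKernel (p.1 - p.2)

/-- The first term is a tensor product of integrable functions; the others are convolution
integrands of `|f|` with the even kernel. -/
theorem integrable_energyBound {f : UnitAddCircle → ℂ} (hf : f ∈ LLog (1 / 2)) :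
    Integrable (energyBound f) ((haarAddCircle : Measure UnitAddCircle).prod haarAddCircle) := by
  have hfi := (integrable_of_mem_LLog_half hf).norm
  have h1 := (hf.2.mul_prod hf.2).const_mul 4
  have h2 := hfi.convolution_integrand (ContinuousLinearMap.mul ℝ ℝ) integrable_singularKernel
  have h3 := h2.swap
  refine (h1.add ((h3.add h2).const_mul 4)).congr (Filter.Eventually.of_forall fun p => ?_)
  simp only [Pi.add_apply, Function.comp_apply, Prod.fst_swap, Prod.snd_swap,
    ContinuousLinearMap.mul_apply', energyBound]
  rw [singularKernel_sub_comm p.2 p.1]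
  ring

theorem norm_log_energy_le (f : UnitAddCircle → ℂ) {r : ℝ} (hr0 : 0 ≤ r) (hr1 : r < 1)
    {p : UnitAddCircle × UnitAddCircle} (hp : fourier 1 (p.1 - p.2) ≠ 1) :
    ‖(starRingEnd ℂ) (f p.1) * f p.2 * -Complex.log (1 - r * fourier 1 (p.1 - p.2))‖ ≤
      energyBound f p := by
  have h1 := norm_log_one_sub_le hr0 hr1 (norm_fourier_apply 1 (p.1 - p.2)) hp
  have hpos : 0 < ‖1 - fourier 1 (p.1 - p.2)‖ := norm_pos_iff.2 (sub_ne_zero.2 hp.symm)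
  rw [norm_mul, norm_mul, RCLike.norm_conj, norm_neg]
  refine (mul_le_mul_of_nonneg_left h1 (by positivity)).trans ?_
  refine (mul_mul_le_of_sqrt_log (norm_nonneg _) (norm_nonneg _)
    ((norm_nonneg _).trans h1)).trans (le_of_eq ?_)
  rw [exp_half_log_eq hpos]
  rfl

theorem fourier_natCast_eq_pow (n : ℕ) (t : UnitAddCircle) :
    fourier (n : ℤ) t = fourier 1 t ^ n := by
  induction n with
  | zero => simp
  | succ n ih => rw [Nat.cast_succ, fourier_add, ih, pow_succ]

theorem fourier_sub_apply (n : ℤ) (x y : UnitAddCircle) :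
    fourier n (x - y) = fourier n x * fourier (-n) y := by
  rw [fourier_apply, fourier_apply, fourier_apply, sub_eq_add_neg, smul_add, smul_neg,
    ← neg_smul, toCircle_add, Circle.coe_mul]

/-- Expand `-log(1 - z) = ∑ zⁿ/n` and integrate termwise, as `r < 1` permits; each character of `x -
y` factors, giving `|f̂(n)|²`. The term `n = 0` vanishes because division by zero gives `0`. -/
theorem hasSum_pow_mul_fourierCoeff_sq {f : UnitAddCircle → ℂ} (hf : Integrable f haarAddCircle)
    {r : ℝ} (hr0 : 0 ≤ r) (hr1 : r < 1) :
    HasSum (fun n : ℕ => ((r ^ n / n * ‖fourierCoeff f n‖ ^ 2 : ℝ) : ℂ))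
      (∫ p : UnitAddCircle × UnitAddCircle, (starRingEnd ℂ) (f p.1) * f p.2 *
        -Complex.log (1 - r * fourier 1 (p.1 - p.2))
        ∂(haarAddCircle : Measure UnitAddCircle).prod haarAddCircle) := by
  have hfc : Integrable (fun x => (starRingEnd ℂ) (f x)) haarAddCircle :=
    hf.norm.mono' (Complex.continuous_conj.comp_aestronglyMeasurable hf.1)
      (Filter.Eventually.of_forall fun x => (RCLike.norm_conj (f x)).le)
  set F : ℕ → UnitAddCircle × UnitAddCircle → ℂ := fun n p =>
    (starRingEnd ℂ) (f p.1) * f p.2 * (((r : ℂ) * fourier 1 (p.1 - p.2)) ^ n / n) with hF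
  have hFeq : ∀ n p, F n p = ((r ^ n / n : ℝ) : ℂ) *
      ((fourier (n : ℤ) p.1 • (starRingEnd ℂ) (f p.1)) * (fourier (-(n : ℤ)) p.2 • f p.2)) := by
    intro n p
    simp only [hF, smul_eq_mul]
    rw [mul_pow, ← fourier_natCast_eq_pow, fourier_sub_apply]
    push_cast
    ring
  have hFint : ∀ n, Integrable (F n)
      ((haarAddCircle : Measure UnitAddCircle).prod haarAddCircle) := by
    intro n
    have h1 := ((hfc.fourier_smul n).mul_prod (hf.fourier_smul (-n))).const_mul
      ((r ^ n / n : ℝ) : ℂ)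
    exact h1.congr (Filter.Eventually.of_forall fun p => (hFeq n p).symm)
  have hFnorm : ∀ n p, ‖F n p‖ = r ^ n / n * (‖f p.1‖ * ‖f p.2‖) := by
    intro n p
    rw [hFeq, norm_mul, norm_mul, norm_smul, norm_smul, norm_fourier_apply, norm_fourier_apply,
      one_mul, one_mul, RCLike.norm_conj, Complex.norm_real, Real.norm_of_nonneg (by positivity)]
  have hsum : Summable fun n => ∫ p, ‖F n p‖
      ∂(haarAddCircle : Measure UnitAddCircle).prod haarAddCircle := by
    simp_rw [hFnorm, integral_const_mul]
    refine Summable.mul_right _ (Summable.of_nonneg_of_le (fun n => by positivity) (fun n => ?_)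
      (summable_geometric_of_lt_one hr0 hr1))
    rcases Nat.eq_zero_or_pos n with rfl | hn
    · simp
    · exact div_le_self (by positivity) (by exact_mod_cast hn)
  have key := hasSum_integral_of_summable_integral_norm hFint hsum
  have htsum : ∀ p, ∑' n, F n p = (starRingEnd ℂ) (f p.1) * f p.2 *
      -Complex.log (1 - r * fourier 1 (p.1 - p.2)) := by
    intro p
    refine ((Complex.hasSum_taylorSeries_neg_log ?_).mul_left _).tsum_eq
    rw [norm_mul, norm_fourier_apply, mul_one, Complex.norm_real, Real.norm_of_nonneg hr0]
    exact hr1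
  simp_rw [htsum] at key
  refine key.congr_fun fun n => ?_
  simp_rw [hFeq]
  rw [integral_const_mul, integral_prod_mul (fun x => fourier (n : ℤ) x • (starRingEnd ℂ) (f x))
    (fun x => fourier (-(n : ℤ)) x • f x)]
  have h2 : ∫ x : UnitAddCircle, fourier (n : ℤ) x • (starRingEnd ℂ) (f x) ∂haarAddCircle =
      (starRingEnd ℂ) (fourierCoeff f n) := by
    rw [fourierCoeff, ← integral_conj]
    congr 1; ext x
    rw [smul_eq_mul, smul_eq_mul, map_mul, fourier_neg, Complex.conj_conj]
  rw [h2, ← fourierCoeff, Complex.conj_mul']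
  push_cast
  ring

/-- All terms are nonnegative, so each finite partial sum at `r < 1` is bounded by the energy, hence
by a constant free of `r`; then let `r → 1`. -/
theorem summable_fourierCoeff_sq_div {f : UnitAddCircle → ℂ} (hf : f ∈ LLog (1 / 2)) :
    Summable fun n : ℕ => ‖fourierCoeff f n‖ ^ 2 / n := by
  have hfi := integrable_of_mem_LLog_half hf
  refine summable_of_sum_le (c := ∫ p, energyBound f p
    ∂(haarAddCircle : Measure UnitAddCircle).prod haarAddCircle) (fun n => by positivity) fun u => ?_
  have hbound : ∀ r ∈ Set.Ioo (0 : ℝ) 1, ∑ n ∈ u, r ^ n / n * ‖fourierCoeff f n‖ ^ 2 ≤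
      ∫ p, energyBound f p ∂(haarAddCircle : Measure UnitAddCircle).prod haarAddCircle := by
    rintro r ⟨hr0, hr1⟩
    have h1 := hasSum_pow_mul_fourierCoeff_sq hfi hr0.le hr1
    have h2 := Complex.hasSum_re h1
    simp only [Complex.ofReal_re] at h2
    refine (sum_le_hasSum u (fun n _ => by positivity) h2).trans ((Complex.re_le_norm _).trans ?_)
    refine norm_integral_le_of_norm_le (integrable_energyBound hf) ?_
    filter_upwards [ae_fourier_one_sub_ne_one] with p hp
    exact norm_log_energy_le f hr0.le hr1 hp
  have hcont : Continuous fun r : ℝ => ∑ n ∈ u, r ^ n / n * ‖fourierCoeff f n‖ ^ 2 := by fun_prop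
  have hlim := (hcont.tendsto 1).mono_left (nhdsWithin_le_nhds (s := Set.Iio 1))
  have hev : ∀ᶠ r : ℝ in nhdsWithin 1 (Set.Iio 1), r ∈ Set.Ioo (0 : ℝ) 1 :=
    Ioo_mem_nhdsLT zero_lt_one
  refine le_trans (le_of_eq ?_) (le_of_tendsto hlim (hev.mono hbound))
  refine Finset.sum_congr rfl fun n _ => ?_
  rw [one_pow]; ring

theorem conj_mem_LLog {s : ℝ} {f : UnitAddCircle → ℂ} (hf : f ∈ LLog s) :
    (fun x => (starRingEnd ℂ) (f x)) ∈ LLog s := by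
  refine ⟨Complex.continuous_conj.comp_aestronglyMeasurable hf.1, ?_⟩
  simpa only [RCLike.norm_conj] using hf.2

theorem norm_fourierCoeff_conj (f : UnitAddCircle → ℂ) (n : ℤ) :
    ‖fourierCoeff (fun x => (starRingEnd ℂ) (f x)) n‖ = ‖fourierCoeff f (-n)‖ := by
  rw [← RCLike.norm_conj, fourierCoeff, fourierCoeff, ← integral_conj]
  congr 2; ext x
  rw [smul_eq_mul, smul_eq_mul, map_mul, fourier_neg, fourier_neg, fourier_neg, Complex.conj_conj,
    Complex.conj_conj]

theorem isMultiplierToL2_invSqrtWeight : IsMultiplierToL2 (LLog (1 / 2)) invSqrtWeight := by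
  refine ⟨⟨1, fun n => ?_⟩, fun f hf => ?_⟩
  · rcases eq_or_ne n 0 with rfl | hn
    · simp [invSqrtWeight]
    · have h1 := norm_invSqrtWeight_sq hn
      have h2 : (1 : ℝ) ≤ |(n : ℝ)| := by exact_mod_cast Int.one_le_abs hn
      have h3 : 1 / |(n : ℝ)| ≤ 1 := (div_le_one (by linarith)).2 h2
      nlinarith [norm_nonneg (invSqrtWeight n)]
  · have hterm : ∀ n : ℤ, ‖invSqrtWeight n * fourierCoeff f n‖ ^ 2 =
        ‖fourierCoeff f n‖ ^ 2 / |(n : ℝ)| := by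
      intro n
      rcases eq_or_ne n 0 with rfl | hn
      · simp [invSqrtWeight]
      · rw [norm_mul, mul_pow, norm_invSqrtWeight_sq hn]; ring
    simp_rw [hterm]
    refine Summable.of_nat_of_neg ?_ ?_
    · simpa using summable_fourierCoeff_sq_div hf
    -- Negative frequencies of `f` are positive frequencies of its conjugate.
    · have := summable_fourierCoeff_sq_div (conj_mem_LLog hf)
      simp_rw [norm_fourierCoeff_conj] at this
      simpa using this

theorem mainTheorem9 :
    IsMultiplierToL2 (LLog (1 / 2)) invSqrtWeight ∧
    SatisfiesRider invSqrtWeight ∧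
    ¬ IsSidonWeight invSqrtWeight ∧
    (¬ ∀ m : ℤ → ℂ, IsMultiplierToL2 (LLog (1 / 2)) m → IsSidonWeight m) ∧
    (¬ ∀ m : ℤ → ℂ, SatisfiesRider m → IsSidonWeight m) :=
  ⟨isMultiplierToL2_invSqrtWeight, satisfiesRider_invSqrtWeight, not_isSidonWeight_invSqrtWeight,
    fun h => not_isSidonWeight_invSqrtWeight (h _ isMultiplierToL2_invSqrtWeight),
    fun h => not_isSidonWeight_invSqrtWeight (h _ satisfiesRider_invSqrtWeight)⟩
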